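/- Let $(N,h)$ be a connected, oriented, real-analytic Riemannian $3$-manifold. Let $u$ be a smooth positive function and $A$ a smooth one-form on $N$ satisfying the monopole equation $du=*dA$, and endow $M=N\times\mathbb{R}$ with the Gibbons–Hawking metric $$g=u\,h+u^{-1}(dt+A)^2,$$ where $t$ is the coordinate on $\mathbb{R}$ and $h$, $u$, $A$ are pulled back by the projection $M\to N$. Let $V=\partial/\partial t$ and, for a vector field $F$ on $N$, let $\widetilde F=F-A(F)\,\partial/\partial t$ be its horizontal lift to $M$, that is, the lift of $F$ on which $dt+A$ vanishes. Let $f$ be a function on $M$ and $F_1$ a vector field on $N$ such that the vector field $E=fV+t\,\widetilde{F_1}$ on $M$ is smooth (in particular, $E$ may be real-analytic), and let $a\in\mathbb{R}$. Then $E$ is a soliton flow on $(M,g)$ with constant $a$, that is, $$\mathrm{Ric}^M+a\,g+\tfrac12\,\mathcal{L}_E\,g=0,$$ if and only if there exist a constant $b\in\mathbb{R}$ and a smooth function $f_0$ on $N$ such that $f=f_0-at+\tfrac14\,b\,t^2$ and the following five relations hold on $N$: $$b=u^{-1}F_1(u),$$ $$bA=2\,du\times F_1^\flat,$$ $$aA+df_0+u^2F_1^\flat=0,$$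 $$\mathcal{L}_{F_1}h=-b\,h,$$ $$\mathrm{Ric}^N+a\,u\,h-u\,A\odot F_1^\flat=0.$$ Here $F_1^\flat=h(F_1,\cdot)$, $\alpha\times\beta=*(\alpha\wedge\beta)$ and $\alpha\odot\beta=\tfrac12(\alpha\otimes\beta+\beta\otimes\alpha)$ for one-forms $\alpha,\beta$ on $N$, and $*$ is the Hodge star of $(N,h)$ with its orientation. -/

import Mathlib

set_option maxSynthPendingDepth 3

open scoped Manifold ContDiff Topology

noncomputable section

namespace GibbonsHawking

section Coordinates

/-! Riemannian geometry on an open subset of a finite-dimensional vector space `W`, for a metric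
`G : W → (W →L[ℝ] W →L[ℝ] ℝ)` given in (linear) coordinates. -/

variable {W : Type*} [NormedAddCommGroup W] [NormedSpace ℝ W]

/-- The derivative of the metric with permuted arguments: `(u, v, w) ↦ ∂_w G(u, v)`. -/
def derivPerm (G : W → W →L[ℝ] W →L[ℝ] ℝ) (y : W) : W →L[ℝ] W →L[ℝ] W →L[ℝ] ℝ :=
  ((ContinuousLinearMap.flipₗᵢ ℝ W W ℝ).toContinuousLinearEquiv :
    (W →L[ℝ] W →L[ℝ] ℝ) →L[ℝ] (W →L[ℝ] W →L[ℝ] ℝ)) ∘L (fderiv ℝ G y).flip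

theorem derivPerm_apply (G : W → W →L[ℝ] W →L[ℝ] ℝ) (y u v w : W) :
    derivPerm G y u v w = fderiv ℝ G y w u v := rfl

/-- Christoffel symbols of the first kind,
`Γ(u, v; w) = ½ (∂_u G(v, w) + ∂_v G(u, w) - ∂_w G(u, v))`, as an iterated linear map. -/
def christoffelLower (G : W → W →L[ℝ] W →L[ℝ] ℝ) (y : W) : W →L[ℝ] W →L[ℝ] W →L[ℝ] ℝ :=
  (1 / 2 : ℝ) • (fderiv ℝ G y + (fderiv ℝ G y).flip - derivPerm G y)

theorem christoffelLower_apply (G : W → W →L[ℝ] W →L[ℝ] ℝ) (y u v w : W) :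
    christoffelLower G y u v w =
      1 / 2 * (fderiv ℝ G y u v w + fderiv ℝ G y v u w - fderiv ℝ G y w u v) := by
  simp [christoffelLower, derivPerm_apply]

/-- Christoffel symbols of the second kind: `Γ(u, v)` is the vector with
`G(Γ(u, v), w) = Γ(u, v; w)`; in coordinates `∇_u v = ∂_u v + Γ(u, v)` for the Levi-Civita
connection `∇` of `G`. Here `(G y).inverse` is the inverse of `W → W*`, `v ↦ G(v, ·)`. -/
def christoffel (G : W → W →L[ℝ] W →L[ℝ] ℝ) (y : W) : W →L[ℝ] W →L[ℝ] W :=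
  (ContinuousLinearMap.compL ℝ W (W →L[ℝ] ℝ) W (G y).inverse) ∘L christoffelLower G y

theorem christoffel_apply (G : W → W →L[ℝ] W →L[ℝ] ℝ) (y u v : W) :
    christoffel G y u v = (G y).inverse (christoffelLower G y u v) := rfl

/-- For fixed `v`, `w`, the linear map `u ↦ R(u, v) w`, where
`R(X, Y) = [∇_X, ∇_Y] - ∇_[X, Y]` is the Riemann curvature of `G`. -/
def curvatureMap (G : W → W →L[ℝ] W →L[ℝ] ℝ) (y v w : W) : W →L[ℝ] W :=
  ((fderiv ℝ (christoffel G) y).flip v).flip w - (fderiv ℝ (christoffel G) y v).flip w +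
    (christoffel G y).flip (christoffel G y v w) -
    (christoffel G y v) ∘L ((christoffel G y).flip w)

theorem curvatureMap_apply (G : W → W →L[ℝ] W →L[ℝ] ℝ) (y u v w : W) :
    curvatureMap G y v w u =
      fderiv ℝ (christoffel G) y u v w - fderiv ℝ (christoffel G) y v u w +
        christoffel G y u (christoffel G y v w) - christoffel G y v (christoffel G y u w) := by
  simp [curvatureMap]

/-- Ricci curvature `Ric(v, w) = trace (u ↦ R(u, v) w)`. -/
def coordRicci (G : W → W →L[ℝ] W →L[ℝ] ℝ) (y v w : W) : ℝ :=
  LinearMap.trace ℝ W (curvatureMap G y v w : W →ₗ[ℝ] W)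

/-- Lie derivative `(L_X G)(v, w) = ∂_X G(v, w) + G(∂_v X, w) + G(v, ∂_w X)`. -/
def coordLieDeriv (G : W → W →L[ℝ] W →L[ℝ] ℝ) (X : W → W) (y v w : W) : ℝ :=
  fderiv ℝ G y (X y) v w + G y (fderiv ℝ X y v) w + G y v (fderiv ℝ X y w)

end Coordinates

section Manifold

/-! Tensors on a boundaryless manifold `M`. The value at `x` of a tensor built from derivatives is
computed in the preferred chart `extChartAt I x` at `x`; the tangent space `TangentSpace I x` is by
definition the model vector space `W`, identified with it by the derivative of that same chart. -/

variable {W : Type*} [NormedAddCommGroup W] [NormedSpace ℝ W]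
  {H : Type*} [TopologicalSpace H] (I : ModelWithCorners ℝ W H)
  {M : Type*} [TopologicalSpace M] [ChartedSpace H M]

/-- The derivative at `y` of the inverse of the chart at `x`. -/
def chartFrame (x : M) (y : W) : W →L[ℝ] TangentSpace I ((extChartAt I x).symm y) :=
  mfderiv 𝓘(ℝ, W) I (extChartAt I x).symm y

/-- The expression in the chart at `x` of a 2-tensor field. -/
def tensorInChart (g : ∀ x : M, TangentSpace I x →L[ℝ] TangentSpace I x →L[ℝ] ℝ) (x : M) :
    W → W →L[ℝ] W →L[ℝ] ℝ := fun y =>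
  (ContinuousLinearMap.precomp ℝ (chartFrame I x y)) ∘L
    (g ((extChartAt I x).symm y)) ∘L (chartFrame I x y)

theorem tensorInChart_apply (g : ∀ x : M, TangentSpace I x →L[ℝ] TangentSpace I x →L[ℝ] ℝ)
    (x : M) (y v w : W) :
    tensorInChart I g x y v w =
      g ((extChartAt I x).symm y) (chartFrame I x y v) (chartFrame I x y w) := rfl

/-- The expression in the chart at `x` of a one-form. -/
def formInChart (A : ∀ x : M, TangentSpace I x →L[ℝ] ℝ) (x : M) : W → W →L[ℝ] ℝ := fun y =>
  (A ((extChartAt I x).symm y)) ∘L (chartFrame I x y)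

/-- The expression in the chart at `x` of a vector field. -/
def fieldInChart (X : ∀ x : M, TangentSpace I x) (x : M) : W → W :=
  VectorField.mpullback 𝓘(ℝ, W) I (extChartAt I x).symm X

/-- The Ricci tensor of the metric `g`. -/
def ricci (g : ∀ x : M, TangentSpace I x →L[ℝ] TangentSpace I x →L[ℝ] ℝ) (x : M)
    (v w : TangentSpace I x) : ℝ :=
  coordRicci (tensorInChart I g x) (extChartAt I x x) v w

/-- The Lie derivative `L_X g`. -/
def lieDeriv (g : ∀ x : M, TangentSpace I x →L[ℝ] TangentSpace I x →L[ℝ] ℝ)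
    (X : ∀ x : M, TangentSpace I x) (x : M) (v w : TangentSpace I x) : ℝ :=
  coordLieDeriv (tensorInChart I g x) (fieldInChart I X x) (extChartAt I x x) v w

/-- The exterior derivative of a one-form, `dA(v, w) = ∂_v A(w) - ∂_w A(v)`, that is,
`dA(X, Y) = X(A(Y)) - Y(A(X)) - A([X, Y])`. -/
def extDerivOne (A : ∀ x : M, TangentSpace I x →L[ℝ] ℝ) (x : M) (v w : TangentSpace I x) : ℝ :=
  fderiv ℝ (formInChart I A x) (extChartAt I x x) v w -
    fderiv ℝ (formInChart I A x) (extChartAt I x x) w v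

/-- `X` is a soliton flow on `(M, g)` with constant `a`: `Ric + a g + ½ L_X g = 0`. -/
def IsSolitonFlow (g : ∀ x : M, TangentSpace I x →L[ℝ] TangentSpace I x →L[ℝ] ℝ)
    (X : ∀ x : M, TangentSpace I x) (a : ℝ) : Prop :=
  ∀ (x : M) (v w : TangentSpace I x),
    ricci I g x v w + a * g x v w + 1 / 2 * lieDeriv I g X x v w = 0

/-- A vector field of class `C^k`. -/
def IsFieldOfClass (k : ℕ∞ω) (X : ∀ x : M, TangentSpace I x) [IsManifold I 1 M] : Prop :=
  ContMDiff I I.tangent k (fun x => (⟨x, X x⟩ : TangentBundle I M))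

/-- A one-form of class `C^k`. -/
def IsFormOfClass (k : ℕ∞ω) (A : ∀ x : M, TangentSpace I x →L[ℝ] ℝ) [IsManifold I 1 M] : Prop :=
  ContMDiff I (I.prod 𝓘(ℝ, W →L[ℝ] ℝ)) k (fun x =>
    Bundle.TotalSpace.mk' (W →L[ℝ] ℝ)
      (E := fun x : M => TangentSpace I x →L[ℝ] Bundle.Trivial M ℝ x) x (A x))

/-- A family of orientations of the tangent spaces of a 3-manifold is an orientation of the
manifold if, for every `x`, it is carried to a constant orientation of the model vector space by
the trivialization of the tangent bundle that is given by the chart at `x`, near `x`. -/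
def IsOrientation [IsManifold I 1 M]
    (o : ∀ x : M, Orientation ℝ (TangentSpace I x) (Fin 3)) : Prop :=
  ∀ x : M, ∀ᶠ y in 𝓝 x,
    ∃ hy : y ∈ (trivializationAt W (TangentSpace I : M → Type _) x).baseSet,
      Orientation.map (Fin 3) ((trivializationAt W (TangentSpace I : M → Type _)
        x).continuousLinearEquivAt ℝ y hy).toLinearEquiv (o y) = (o x : Orientation ℝ W (Fin 3))

end Manifold

section LinearAlgebra

variable {T : Type*} [AddCommGroup T] [Module ℝ T] [TopologicalSpace T]

/-- `e` is a positively oriented orthonormal basis of the oriented Euclidean 3-space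
`(T, B, o)`. -/
def IsPosOrthonormal (B : T →L[ℝ] T →L[ℝ] ℝ) (o : Orientation ℝ T (Fin 3))
    (e : Module.Basis (Fin 3) ℝ T) : Prop :=
  (∀ i j, B (e i) (e j) = if i = j then 1 else 0) ∧ e.orientation = o

/-- `α = *β` for a one-form `α` and a two-form `β` on an oriented Euclidean 3-space:
`α(e₁) = β(e₂, e₃)`, `α(e₂) = β(e₃, e₁)`, `α(e₃) = β(e₁, e₂)` in positive orthonormal bases
(the indices are taken modulo 3). -/
def IsHodgeStar (B : T →L[ℝ] T →L[ℝ] ℝ) (o : Orientation ℝ T (Fin 3))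
    (α : T → ℝ) (β : T → T → ℝ) : Prop :=
  ∀ e : Module.Basis (Fin 3) ℝ T, IsPosOrthonormal B o e →
    ∀ i : Fin 3, α (e i) = β (e (i + 1)) (e (i + 2))

/-- `γ = α × β` for one-forms on an oriented Euclidean 3-space, that is, `γ = *(α ∧ β)`. -/
def IsCross (B : T →L[ℝ] T →L[ℝ] ℝ) (o : Orientation ℝ T (Fin 3)) (γ α β : T → ℝ) : Prop :=
  IsHodgeStar B o γ (fun v w => α v * β w - α w * β v)

/-- The symmetric product `α ⊙ β = ½ (α ⊗ β + β ⊗ α)` of one-forms. -/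
def symProd (α β : T → ℝ) (v w : T) : ℝ :=
  1 / 2 * (α v * β w + β v * α w)

end LinearAlgebra

section Construction

variable {W : Type*} [NormedAddCommGroup W] [NormedSpace ℝ W]
  {H : Type*} [TopologicalSpace H] (I : ModelWithCorners ℝ W H)
  {N : Type*} [TopologicalSpace N] [ChartedSpace H N]

/-- The one-form `θ = dt + A` on `N × ℝ`; `t` is the second coordinate and `A` stands for its
pull-back by the projection to `N`. -/
def theta (A : ∀ x : N, TangentSpace I x →L[ℝ] ℝ) (p : N × ℝ) :
    TangentSpace (I.prod 𝓘(ℝ, ℝ)) p →L[ℝ] ℝ :=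
  mvfderiv (I.prod 𝓘(ℝ, ℝ)) (Prod.snd : N × ℝ → ℝ) p +
    (A p.1) ∘L (mfderiv (I.prod 𝓘(ℝ, ℝ)) I (Prod.fst : N × ℝ → N) p)

/-- The metric `g = u h + u⁻¹ (dt + A)²` on `N × ℝ`. -/
def metric (h : ∀ x : N, TangentSpace I x →L[ℝ] TangentSpace I x →L[ℝ] ℝ) (u : N → ℝ)
    (A : ∀ x : N, TangentSpace I x →L[ℝ] ℝ) (p : N × ℝ) :
    TangentSpace (I.prod 𝓘(ℝ, ℝ)) p →L[ℝ] TangentSpace (I.prod 𝓘(ℝ, ℝ)) p →L[ℝ] ℝ :=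
  u p.1 • ((ContinuousLinearMap.precomp ℝ
      (mfderiv (I.prod 𝓘(ℝ, ℝ)) I (Prod.fst : N × ℝ → N) p)) ∘L
      (h p.1) ∘L (mfderiv (I.prod 𝓘(ℝ, ℝ)) I (Prod.fst : N × ℝ → N) p)) +
    (u p.1)⁻¹ • (theta I A p).smulRight (theta I A p)

theorem metric_apply (h : ∀ x : N, TangentSpace I x →L[ℝ] TangentSpace I x →L[ℝ] ℝ) (u : N → ℝ)
    (A : ∀ x : N, TangentSpace I x →L[ℝ] ℝ) (p : N × ℝ)
    (v w : TangentSpace (I.prod 𝓘(ℝ, ℝ)) p) :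
    metric I h u A p v w =
      u p.1 * h p.1 (mfderiv (I.prod 𝓘(ℝ, ℝ)) I (Prod.fst : N × ℝ → N) p v)
          (mfderiv (I.prod 𝓘(ℝ, ℝ)) I (Prod.fst : N × ℝ → N) p w) +
        (u p.1)⁻¹ * (theta I A p v * theta I A p w) := rfl

/-- The vector field `V = ∂/∂t` on `N × ℝ`. The tangent space at `(x, t)` is `T_x N × ℝ`. -/
def vertical (p : N × ℝ) : TangentSpace (I.prod 𝓘(ℝ, ℝ)) p :=
  ((0, 1) : W × ℝ)

/-- The horizontal lift `F - A(F) ∂/∂t` to `N × ℝ` of a vector field `F` on `N`: the lift of `F`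
that is annihilated by `θ = dt + A`. -/
def horizontalLift (A : ∀ x : N, TangentSpace I x →L[ℝ] ℝ) (F : ∀ x : N, TangentSpace I x)
    (p : N × ℝ) : TangentSpace (I.prod 𝓘(ℝ, ℝ)) p :=
  ((F p.1, -A p.1 (F p.1)) : W × ℝ)

/-- The vector field `E = f V + t F̃` on `N × ℝ`, where `F̃` is the horizontal lift of `F`. -/
def flowField (A : ∀ x : N, TangentSpace I x →L[ℝ] ℝ) (f : N × ℝ → ℝ)
    (F : ∀ x : N, TangentSpace I x) (p : N × ℝ) : TangentSpace (I.prod 𝓘(ℝ, ℝ)) p :=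
  f p • vertical I p + p.2 • horizontalLift I A F p

end Construction

end GibbonsHawking

end

/-! The proof combines a formula for the Ricci tensor of `M`, a formula for the Lie derivative of
`g`, and a separation of variables in the fibre direction and in `t`.

Ricci tensor. Write θ = dt + A, let q be the gradient of u and J the skew endomorphism given by dA.
In the frame (v, r) ↦ (v, θ(v, r)) the Levi-Civita connection of g is that of h plus a tensor built
from u, q and J: the frame absorbs every derivative of A that is not part of dA. Hence the curvature
of g is that of h plus an algebraic expression in u, q, J, ∇q and ∇J (`frame_curvatureMap`). The
monopole equation says dA = ι_q vol. Since vol is parallel, ∇J is obtained from ∇q as J is from q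
(`inner_covCurl_eq`), and d(dA) = 0 says that ∇q has trace zero. After these substitutions the trace
of the extra term vanishes identically (`trace_curvHor_add_curvVer`), so the Ricci tensor of g is
the pull-back of that of h (`coordRicci_coordMetric_of_monopole`).

Lie derivative. The essential input is L_E θ = df + t ι_{F₁} dA; see `coordLieDeriv_coordMetric`.

Separation. The left side of the soliton equation is `solitonExpression`, evaluated on pairs of
vectors of T_xN × ℝ. Its vertical-vertical part reads ∂f/∂t = -a + ½ u⁻¹F₁(u) t, which makes f
quadratic in t. The mixed and horizontal parts then become polynomial identities in t. The t²
coefficient of the mixed part says that u⁻¹F₁(u) has zero differential, hence is a constant b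
because N is connected; the other coefficients are the remaining relations (`exists_baseRelations`).
The relation found first is bA = 2 dA(F₁, ·), and the monopole equation turns it into the cross
product (`isCross_iff`). Conversely, the relations make the expression vanish
(`BaseRelations.solitonExpression_eq_zero`).

Tensors at a point are computed in the chart centred there, while the Ricci argument differentiates
the monopole equation. That equation must therefore hold in one chart throughout a neighbourhood,
which requires the naturality of d and the local constancy of the orientation
(`isMonopoleNear_of_isHodgeStar`). -/

noncomputable section

namespace GibbonsHawking


/-! ### Inner products in coordinates and the Levi-Civita connection. -/

section Basics

variable {W : Type*} [NormedAddCommGroup W] [NormedSpace ℝ W]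

/-- A symmetric positive definite bilinear form. -/
structure IsInnerForm (B : W →L[ℝ] W →L[ℝ] ℝ) : Prop where
  symm : ∀ v w, B v w = B w v
  pos : ∀ v, v ≠ 0 → 0 < B v v

theorem IsInnerForm.ext_left {B : W →L[ℝ] W →L[ℝ] ℝ} (hB : IsInnerForm B) {v v' : W}
    (H : ∀ w, B v w = B v' w) : v = v' := by
  by_contra hne
  have := hB.pos (v - v') (sub_ne_zero.mpr hne)
  have h0 : B (v - v') = 0 := by ext w; simp [H]
  simp [h0] at this

theorem IsInnerForm.isInvertible [FiniteDimensional ℝ W] {B : W →L[ℝ] W →L[ℝ] ℝ}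
    (hB : IsInnerForm B) : B.IsInvertible := by
  have hinj : Function.Injective B := fun v v' hvv => hB.ext_left fun w => by rw [hvv]
  have hdim : Module.finrank ℝ W = Module.finrank ℝ (W →L[ℝ] ℝ) := by
    rw [← (LinearMap.toContinuousLinearMap (𝕜 := ℝ) (E := W) (F' := ℝ)).finrank_eq]
    exact (Subspace.dual_finrank_eq (K := ℝ) (V := W)).symm
  exact ⟨(LinearEquiv.ofInjectiveOfFinrankEq (B : W →ₗ[ℝ] (W →L[ℝ] ℝ)) hinj
    hdim).toContinuousLinearEquiv, by ext; rfl⟩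

/-- The gradient vector dual to a covector. -/
theorem IsInnerForm.inverse_apply [FiniteDimensional ℝ W] {B : W →L[ℝ] W →L[ℝ] ℝ}
    (hB : IsInnerForm B) (α : W →L[ℝ] ℝ) (w : W) : B (B.inverse α) w = α w := by
  rw [hB.isInvertible.self_apply_inverse]

theorem IsInnerForm.inverse_eq [FiniteDimensional ℝ W] {B : W →L[ℝ] W →L[ℝ] ℝ}
    (hB : IsInnerForm B) {α : W →L[ℝ] ℝ} {z : W} (h : ∀ w, B z w = α w) : B.inverse α = z :=
  hB.ext_left fun w => by rw [hB.inverse_apply, h]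

theorem contDiffAt_inverse [FiniteDimensional ℝ W] {E : Type*} [NormedAddCommGroup E]
    [NormedSpace ℝ E] {G : E → W →L[ℝ] W →L[ℝ] ℝ} {y : E} {n : ℕ∞ω}
    (hG : ContDiffAt ℝ n G y) (hB : IsInnerForm (G y)) :
    ContDiffAt ℝ n (fun z => (G z).inverse) y := by
  obtain ⟨e, he⟩ := hB.isInvertible
  have := contDiffAt_map_inverse (𝕜 := ℝ) (n := n) e
  rw [he] at this
  exact this.comp y hG

theorem contDiffAt_christoffelLower {G : W → W →L[ℝ] W →L[ℝ] ℝ} {y : W}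
    (hG : ContDiffAt ℝ ∞ G y) : ContDiffAt ℝ ∞ (christoffelLower G) y := by
  have h1 : ContDiffAt ℝ ∞ (fderiv ℝ G) y := hG.fderiv_right (by simp)
  unfold christoffelLower derivPerm
  have h2 : ContDiffAt ℝ ∞ (fun y => (fderiv ℝ G y).flip) y :=
    (ContinuousLinearMap.flipₗᵢ ℝ W W (W →L[ℝ] ℝ)).toContinuousLinearEquiv.contDiff.contDiffAt.comp y h1
  exact ((h1.add h2).sub (contDiffAt_const.clm_comp h2)).const_smul _

theorem contDiffAt_christoffel [FiniteDimensional ℝ W] {G : W → W →L[ℝ] W →L[ℝ] ℝ} {y : W}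
    (hG : ContDiffAt ℝ ∞ G y) (hB : IsInnerForm (G y)) : ContDiffAt ℝ ∞ (christoffel G) y := by
  unfold christoffel
  exact ((ContinuousLinearMap.compL ℝ W (W →L[ℝ] ℝ) W).contDiff.contDiffAt.comp y
    (contDiffAt_inverse hG hB)).clm_comp (contDiffAt_christoffelLower hG)

theorem inner_christoffel [FiniteDimensional ℝ W] {G : W → W →L[ℝ] W →L[ℝ] ℝ} {y : W}
    (hB : IsInnerForm (G y)) (u v w : W) :
    G y (christoffel G y u v) w = christoffelLower G y u v w := by
  rw [christoffel_apply, hB.inverse_apply]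

theorem christoffel_eq [FiniteDimensional ℝ W] {G : W → W →L[ℝ] W →L[ℝ] ℝ} {y : W}
    (hB : IsInnerForm (G y)) {u v z : W}
    (h : ∀ w, G y z w = christoffelLower G y u v w) : christoffel G y u v = z := by
  rw [christoffel_apply, hB.inverse_eq h]

theorem fderiv_symm_of_eventually {E : Type*} [NormedAddCommGroup E] [NormedSpace ℝ E]
    {G : E → W →L[ℝ] W →L[ℝ] ℝ} {y : E} (hG : DifferentiableAt ℝ G y)
    (hs : ∀ᶠ z in 𝓝 y, IsInnerForm (G z)) (x : E) (v w : W) :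
    fderiv ℝ G y x v w = fderiv ℝ G y x w v := by
  have key : ∀ v w : W, HasFDerivAt (fun z => G z v w)
      (((ContinuousLinearMap.apply ℝ ℝ w).comp (ContinuousLinearMap.apply ℝ _ v)).comp
        (fderiv ℝ G y)) y := fun v w =>
    ((ContinuousLinearMap.apply ℝ ℝ w).comp
      (ContinuousLinearMap.apply ℝ (W →L[ℝ] ℝ) v)).hasFDerivAt.comp y hG.hasFDerivAt
  have h2 : (fun z => G z v w) =ᶠ[𝓝 y] fun z => G z w v := by
    filter_upwards [hs] with z hz using hz.symm v w
  have := (key v w).unique ((key w v).congr_of_eventuallyEq h2)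
  exact congrArg (fun L => L x) this

theorem christoffel_symm [FiniteDimensional ℝ W] {G : W → W →L[ℝ] W →L[ℝ] ℝ} {y : W}
    (hG : DifferentiableAt ℝ G y) (hs : ∀ᶠ z in 𝓝 y, IsInnerForm (G z)) (u v : W) :
    christoffel G y u v = christoffel G y v u := by
  refine christoffel_eq hs.self_of_nhds fun w => ?_
  rw [inner_christoffel hs.self_of_nhds, christoffelLower_apply, christoffelLower_apply,
    fderiv_symm_of_eventually hG hs w u v]
  ring

/-- Metric compatibility, ∇G = 0. With the symmetry of Γ it allows every derivative of the metric to
be traded for Christoffel terms. -/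
theorem fderiv_eq_christoffel [FiniteDimensional ℝ W] {G : W → W →L[ℝ] W →L[ℝ] ℝ} {y : W}
    (hG : DifferentiableAt ℝ G y) (hs : ∀ᶠ z in 𝓝 y, IsInnerForm (G z)) (x v w : W) :
    fderiv ℝ G y x v w = G y (christoffel G y x v) w + G y v (christoffel G y x w) := by
  have hB := hs.self_of_nhds
  rw [hB.symm v, inner_christoffel hB, inner_christoffel hB, christoffelLower_apply,
    christoffelLower_apply]
  have := fun x v w => fderiv_symm_of_eventually hG hs x v w
  rw [this v x w, this w x v]
  linarith [this x v w]

end Basics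

/-! ### Change of frame for a connection and its curvature. -/

section Gauge

variable {E : Type*} [NormedAddCommGroup E] [NormedSpace ℝ E]

/-- The gauge transform `X ↦ P Γ(X) P⁻¹ - (∂_X P) P⁻¹` of a connection form, where `Q = P⁻¹`. -/
def gauge (Γ : E → E →L[ℝ] E →L[ℝ] E) (P Q : E → E →L[ℝ] E) (p : E) : E →L[ℝ] E →L[ℝ] E :=
  ((ContinuousLinearMap.precomp E (Q p)) ∘L (ContinuousLinearMap.compL ℝ E E E (P p)) ∘L Γ p) -
    (ContinuousLinearMap.precomp E (Q p)) ∘L fderiv ℝ P p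

theorem gauge_apply (Γ : E → E →L[ℝ] E →L[ℝ] E) (P Q : E → E →L[ℝ] E) (p X Z : E) :
    gauge Γ P Q p X Z = P p (Γ p X (Q p Z)) - fderiv ℝ P p X (Q p Z) := rfl

theorem hasFDerivAt_apply_apply {E' F F' : Type*} [NormedAddCommGroup E'] [NormedSpace ℝ E']
    [NormedAddCommGroup F] [NormedSpace ℝ F] [NormedAddCommGroup F'] [NormedSpace ℝ F']
    {L : E → E' →L[ℝ] F →L[ℝ] F'} {p : E} (hL : DifferentiableAt ℝ L p) (X : E') (Z : F) :
    HasFDerivAt (fun z => L z X Z) (((ContinuousLinearMap.apply ℝ F' Z).comp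
      (ContinuousLinearMap.apply ℝ (F →L[ℝ] F') X)).comp (fderiv ℝ L p)) p :=
  ((ContinuousLinearMap.apply ℝ F' Z).comp
      (ContinuousLinearMap.apply ℝ (F →L[ℝ] F') X)).hasFDerivAt.comp p hL.hasFDerivAt

theorem differentiableAt_gauge {Γ : E → E →L[ℝ] E →L[ℝ] E} {P Q : E → E →L[ℝ] E} {p : E}
    (hΓ : DifferentiableAt ℝ Γ p) (hP : ContDiffAt ℝ ∞ P p) (hQ : DifferentiableAt ℝ Q p) :
    DifferentiableAt ℝ (gauge Γ P Q) p := by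
  have h1 : DifferentiableAt ℝ (fderiv ℝ P) p :=
    (hP.fderiv_right (m := ∞) (by simp)).differentiableAt (by simp)
  have h0 : DifferentiableAt ℝ P p := hP.differentiableAt (by simp)
  have hq : DifferentiableAt ℝ (fun p => ContinuousLinearMap.precomp E (Q p)) p :=
    ((ContinuousLinearMap.compL ℝ E E E).flip.differentiableAt).comp p hQ
  have hp : DifferentiableAt ℝ (fun p => ContinuousLinearMap.compL ℝ E E E (P p)) p :=
    ((ContinuousLinearMap.compL ℝ E E E).differentiableAt).comp p h0
  unfold gauge
  exact (hq.clm_comp (hp.clm_comp hΓ)).sub (hq.clm_comp h1)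

/-- Curvature transforms as a tensor under gauge transformations. -/
theorem curvature_gauge {Γ : E → E →L[ℝ] E →L[ℝ] E} {P Q : E → E →L[ℝ] E} {p : E}
    (hΓ : DifferentiableAt ℝ Γ p) (hP : ContDiffAt ℝ ∞ P p) (hQ : DifferentiableAt ℝ Q p)
    (hQP : ∀ᶠ z in 𝓝 p, ∀ Z, Q z (P z Z) = Z) (X Y Z : E) :
    P p (fderiv ℝ Γ p X Y Z - fderiv ℝ Γ p Y X Z + Γ p X (Γ p Y Z) - Γ p Y (Γ p X Z)) =
      fderiv ℝ (gauge Γ P Q) p X Y (P p Z) - fderiv ℝ (gauge Γ P Q) p Y X (P p Z) +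
        gauge Γ P Q p X (gauge Γ P Q p Y (P p Z)) -
        gauge Γ P Q p Y (gauge Γ P Q p X (P p Z)) := by
  have hω := differentiableAt_gauge hΓ hP hQ
  have h1 : DifferentiableAt ℝ (fderiv ℝ P) p :=
    (hP.fderiv_right (m := ∞) (by simp)).differentiableAt (by simp)
  have h0 : DifferentiableAt ℝ P p := hP.differentiableAt (by simp)
  have hsym : ∀ X Y, fderiv ℝ (fderiv ℝ P) p X Y = fderiv ℝ (fderiv ℝ P) p Y X :=
    hP.isSymmSndFDerivAt (by
      simpa using (WithTop.coe_le_coe.2 le_top : ((2 : ℕ∞) : ℕ∞ω) ≤ ∞))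
  -- The definition of ω = `gauge Γ P Q` multiplied through by P: P Γ(X) = ω(X) P + ∂_X P. In this
  -- form the inverse Q need not be differentiated.
  have rel : ∀ᶠ z in 𝓝 p, ∀ X Z, P z (Γ z X Z) = gauge Γ P Q z X (P z Z) + fderiv ℝ P z X Z := by
    filter_upwards [hQP] with z hz X Z
    rw [gauge_apply, hz]; abel
  -- The derivative of `rel` along Y. Its last term is a second derivative of P, which cancels when
  -- X and Y are exchanged and the results subtracted.
  have key : ∀ X Y Z, fderiv ℝ P p Y (Γ p X Z) + P p (fderiv ℝ Γ p Y X Z) =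
      fderiv ℝ (gauge Γ P Q) p Y X (P p Z) + gauge Γ P Q p X (fderiv ℝ P p Y Z) +
        fderiv ℝ (fderiv ℝ P) p Y X Z := by
    intro X Y Z
    have d1 := h0.hasFDerivAt.clm_apply (hasFDerivAt_apply_apply hΓ X Z)
    have hPZ : HasFDerivAt (fun z => P z Z) _ p :=
      (ContinuousLinearMap.apply ℝ E Z).hasFDerivAt.comp p h0.hasFDerivAt
    have hωX : HasFDerivAt (fun z => gauge Γ P Q z X) _ p :=
      (ContinuousLinearMap.apply ℝ (E →L[ℝ] E) X).hasFDerivAt.comp p hω.hasFDerivAt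
    have d2 := (hωX.clm_apply hPZ).add (hasFDerivAt_apply_apply h1 X Z)
    have := congrArg (fun L => L Y) (d1.unique (d2.congr_of_eventuallyEq
      (rel.mono fun z hz => hz X Z)))
    simp at this
    rw [add_comm, this]; abel
  have r := rel.self_of_nhds
  have e1 := key Y X Z
  have e2 := key X Y Z
  rw [hsym] at e1
  have r1 := r X (Γ p Y Z)
  have r2 := r Y (Γ p X Z)
  rw [r Y Z, map_add] at r1
  rw [r X Z, map_add] at r2
  simp only [map_add, map_sub]
  rw [r1, r2]
  have e1' := eq_sub_of_add_eq' e1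
  have e2' := eq_sub_of_add_eq' e2
  rw [e1', e2']
  abel

end Gauge


/-! ### The Gibbons–Hawking metric in a chart and its connection in the adapted frame. -/

section LocalMetric

variable {W : Type*} [NormedAddCommGroup W] [NormedSpace ℝ W]

/-- The one-form `dt + A` on `W × ℝ`. -/
def connForm (A : W → W →L[ℝ] ℝ) (p : W × ℝ) : W × ℝ →L[ℝ] ℝ :=
  ContinuousLinearMap.snd ℝ W ℝ + A p.1 ∘L ContinuousLinearMap.fst ℝ W ℝ

theorem connForm_apply (A : W → W →L[ℝ] ℝ) (p X : W × ℝ) : connForm A p X = X.2 + A p.1 X.1 := rfl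

/-- The Gibbons–Hawking metric on `W × ℝ`. -/
def coordMetric (h : W → W →L[ℝ] W →L[ℝ] ℝ) (u : W → ℝ) (A : W → W →L[ℝ] ℝ) (p : W × ℝ) :
    W × ℝ →L[ℝ] W × ℝ →L[ℝ] ℝ :=
  u p.1 • ((ContinuousLinearMap.precomp ℝ (ContinuousLinearMap.fst ℝ W ℝ)) ∘L
      (h p.1 ∘L ContinuousLinearMap.fst ℝ W ℝ)) +
    (u p.1)⁻¹ • (connForm A p).smulRight (connForm A p)

theorem coordMetric_apply (h : W → W →L[ℝ] W →L[ℝ] ℝ) (u : W → ℝ) (A : W → W →L[ℝ] ℝ)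
    (p X Y : W × ℝ) : coordMetric h u A p X Y = u p.1 * h p.1 X.1 Y.1 +
      (u p.1)⁻¹ * (connForm A p X * connForm A p Y) := rfl

/-- Smoothness and positivity near `y` of the data of a Gibbons–Hawking metric. -/
structure IsLocalData (h : W → W →L[ℝ] W →L[ℝ] ℝ) (u : W → ℝ) (A : W → W →L[ℝ] ℝ) (y : W) :
    Prop where
  smooth_h : ∀ᶠ z in 𝓝 y, ContDiffAt ℝ ∞ h z
  inner : ∀ᶠ z in 𝓝 y, IsInnerForm (h z)
  smooth_u : ∀ᶠ z in 𝓝 y, ContDiffAt ℝ ∞ u z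
  pos : ∀ᶠ z in 𝓝 y, 0 < u z
  smooth_A : ∀ᶠ z in 𝓝 y, ContDiffAt ℝ ∞ A z

variable {h : W → W →L[ℝ] W →L[ℝ] ℝ} {u : W → ℝ} {A : W → W →L[ℝ] ℝ} {y : W} {p : W × ℝ}

theorem IsLocalData.eventually (H : IsLocalData h u A y) : ∀ᶠ z in 𝓝 y, IsLocalData h u A z := by
  filter_upwards [H.smooth_h.eventually_nhds, H.inner.eventually_nhds, H.smooth_u.eventually_nhds,
    H.pos.eventually_nhds, H.smooth_A.eventually_nhds] with z h1 h2 h3 h4 h5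
  exact ⟨h1, h2, h3, h4, h5⟩

theorem contDiffAt_connForm (H : IsLocalData h u A p.1) : ContDiffAt ℝ ∞ (connForm A) p :=
  contDiffAt_const.add ((H.smooth_A.self_of_nhds.comp p contDiffAt_fst).clm_comp contDiffAt_const)

theorem contDiffAt_coordMetric (H : IsLocalData h u A p.1) :
    ContDiffAt ℝ ∞ (coordMetric h u A) p := by
  have hu : ContDiffAt ℝ ∞ (fun p : W × ℝ => u p.1) p :=
    H.smooth_u.self_of_nhds.comp p contDiffAt_fst
  have hh : ContDiffAt ℝ ∞ (fun p : W × ℝ => h p.1) p :=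
    H.smooth_h.self_of_nhds.comp p contDiffAt_fst
  have hθ := contDiffAt_connForm H
  exact (hu.smul (contDiffAt_const.clm_comp (hh.clm_comp contDiffAt_const))).add
    ((hu.inv H.pos.self_of_nhds.ne').smul (hθ.smulRight hθ))

theorem isInnerForm_coordMetric (hB : IsInnerForm (h p.1)) (hu : 0 < u p.1) :
    IsInnerForm (coordMetric h u A p) where
  symm X Y := by rw [coordMetric_apply, coordMetric_apply, hB.symm]; ring
  pos X hX := by
    rw [coordMetric_apply]
    have hi := inv_pos.mpr hu
    by_cases h1 : X.1 = 0
    · have h2 : X.2 ≠ 0 := fun h2 => hX (Prod.ext h1 h2)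
      have : 0 < X.2 * X.2 := mul_self_pos.mpr h2
      simp only [connForm_apply, h1, map_zero, mul_zero, add_zero, zero_add]
      positivity
    · have := hB.pos _ h1
      have h3 := mul_self_nonneg (connForm A p X)
      positivity

theorem eventually_fst {X Y : Type*} [TopologicalSpace X] [TopologicalSpace Y] {p : X × Y}
    {q : X → Prop} (H : ∀ᶠ z in 𝓝 p.1, q z) : ∀ᶠ z in 𝓝 p, q z.1 :=
  continuousAt_fst.eventually H

/-- Fréchet derivatives are evaluated below as one-variable derivatives along lines: the ordinary
product and inverse rules apply, and uniqueness of the derivative yields the formula. -/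
theorem hasDerivAt_line {E F : Type*} [NormedAddCommGroup E] [NormedSpace ℝ E]
    [NormedAddCommGroup F] [NormedSpace ℝ F] {f : E → F} {p : E} (hf : DifferentiableAt ℝ f p)
    (X : E) : HasDerivAt (fun s : ℝ => f (p + s • X)) (fderiv ℝ f p X) 0 :=
  hf.hasFDerivAt.hasLineDerivAt X

theorem hasDerivAt_line_apply {E F F' : Type*} [NormedAddCommGroup E] [NormedSpace ℝ E]
    [NormedAddCommGroup F] [NormedSpace ℝ F] [NormedAddCommGroup F'] [NormedSpace ℝ F']
    {f : E → F →L[ℝ] F'} {p : E} (hf : DifferentiableAt ℝ f p)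
    (X : E) (v : F) : HasDerivAt (fun s : ℝ => f (p + s • X) v) (fderiv ℝ f p X v) 0 :=
  (ContinuousLinearMap.apply ℝ F' v).hasFDerivAt.comp_hasDerivAt 0 (hasDerivAt_line hf X)

theorem hasDerivAt_line_apply_apply {E F F' F'' : Type*} [NormedAddCommGroup E] [NormedSpace ℝ E]
    [NormedAddCommGroup F] [NormedSpace ℝ F] [NormedAddCommGroup F'] [NormedSpace ℝ F']
    [NormedAddCommGroup F''] [NormedSpace ℝ F'']
    {f : E → F →L[ℝ] F' →L[ℝ] F''} {p : E} (hf : DifferentiableAt ℝ f p)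
    (X : E) (v : F) (w : F') :
    HasDerivAt (fun s : ℝ => f (p + s • X) v w) (fderiv ℝ f p X v w) 0 :=
  (ContinuousLinearMap.apply ℝ F'' w).hasFDerivAt.comp_hasDerivAt 0 (hasDerivAt_line_apply hf X v)

theorem IsLocalData.diff_h (H : IsLocalData h u A y) : DifferentiableAt ℝ h y :=
  H.smooth_h.self_of_nhds.differentiableAt (by simp)
theorem IsLocalData.diff_u (H : IsLocalData h u A y) : DifferentiableAt ℝ u y :=
  H.smooth_u.self_of_nhds.differentiableAt (by simp)
theorem IsLocalData.diff_A (H : IsLocalData h u A y) : DifferentiableAt ℝ A y :=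
  H.smooth_A.self_of_nhds.differentiableAt (by simp)

theorem fderiv_coordMetric (H : IsLocalData h u A p.1) (X Y Z : W × ℝ) :
    fderiv ℝ (coordMetric h u A) p X Y Z =
      fderiv ℝ u p.1 X.1 * h p.1 Y.1 Z.1 + u p.1 * fderiv ℝ h p.1 X.1 Y.1 Z.1 -
        fderiv ℝ u p.1 X.1 * ((u p.1)⁻¹) ^ 2 * (connForm A p Y * connForm A p Z) +
        (u p.1)⁻¹ * (fderiv ℝ A p.1 X.1 Y.1 * connForm A p Z +
          connForm A p Y * fderiv ℝ A p.1 X.1 Z.1) := by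
  have h0 := hasDerivAt_line_apply_apply
    ((contDiffAt_coordMetric H).differentiableAt (by simp)) X Y Z
  have hu := hasDerivAt_line H.diff_u X.1
  have hA := hasDerivAt_line_apply H.diff_A X.1
  have hh := hasDerivAt_line_apply_apply H.diff_h X.1 Y.1 Z.1
  have hne : u (p.1 + (0 : ℝ) • X.1) ≠ 0 := by simpa using H.pos.self_of_nhds.ne'
  have h1 := (hu.mul hh).add ((hu.inv hne).mul
    (((hA Y.1).const_add Y.2).mul ((hA Z.1).const_add Z.2)))
  have := h0.unique h1
  rw [this]
  simp only [zero_smul, add_zero, connForm_apply]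
  simp
  ring

/-- The gradient of `u`. -/
def grad (h : W → W →L[ℝ] W →L[ℝ] ℝ) (u : W → ℝ) (y : W) : W := (h y).inverse (fderiv ℝ u y)

/-- The exterior derivative of `A`. -/
def curl (A : W → W →L[ℝ] ℝ) (y : W) : W →L[ℝ] W →L[ℝ] ℝ := fderiv ℝ A y - (fderiv ℝ A y).flip

theorem curl_apply (A : W → W →L[ℝ] ℝ) (y v w : W) :
    curl A y v w = fderiv ℝ A y v w - fderiv ℝ A y w v := rfl

/-- The exterior derivative of `A` as a skew endomorphism. -/
def curlOp (h : W → W →L[ℝ] W →L[ℝ] ℝ) (A : W → W →L[ℝ] ℝ) (y : W) : W →L[ℝ] W :=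
  (h y).inverse ∘L curl A y

/-- The frame `(v, r) ↦ (v, (dt + A)(v, r))`. -/
def frame (A : W → W →L[ℝ] ℝ) (p : W × ℝ) : W × ℝ →L[ℝ] W × ℝ :=
  (ContinuousLinearMap.fst ℝ W ℝ).prod (connForm A p)

/-- The inverse of `frame`. -/
def coframe (A : W → W →L[ℝ] ℝ) (p : W × ℝ) : W × ℝ →L[ℝ] W × ℝ :=
  frame (fun y => -A y) p

theorem frame_apply (A : W → W →L[ℝ] ℝ) (p X : W × ℝ) : frame A p X = (X.1, X.2 + A p.1 X.1) := rfl

theorem coframe_apply (A : W → W →L[ℝ] ℝ) (p X : W × ℝ) :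
    coframe A p X = (X.1, X.2 - A p.1 X.1) := by
  simp [coframe, frame_apply, sub_eq_add_neg]

theorem frame_coframe (A : W → W →L[ℝ] ℝ) (p X : W × ℝ) : frame A p (coframe A p X) = X := by
  simp [coframe_apply, frame_apply]

theorem coframe_frame (A : W → W →L[ℝ] ℝ) (p X : W × ℝ) : coframe A p (frame A p X) = X := by
  simp [coframe_apply, frame_apply]

theorem connForm_coframe (A : W → W →L[ℝ] ℝ) (p X : W × ℝ) :
    connForm A p (coframe A p X) = X.2 := by
  simp [coframe_apply, connForm_apply]

theorem contDiffAt_frame (H : IsLocalData h u A p.1) : ContDiffAt ℝ ∞ (frame A) p := by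
  have h1 : frame A = fun p => ContinuousLinearMap.inl ℝ W ℝ ∘L ContinuousLinearMap.fst ℝ W ℝ +
      ContinuousLinearMap.inr ℝ W ℝ ∘L connForm A p := by
    ext <;> simp [frame_apply, connForm_apply]
  rw [h1]
  exact contDiffAt_const.add (contDiffAt_const.clm_comp (contDiffAt_connForm H))

theorem IsLocalData.neg (H : IsLocalData h u A y) : IsLocalData h u (fun y => -A y) y :=
  ⟨H.smooth_h, H.inner, H.smooth_u, H.pos, H.smooth_A.mono fun _ hz => hz.neg⟩

theorem contDiffAt_coframe (H : IsLocalData h u A p.1) : ContDiffAt ℝ ∞ (coframe A) p :=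
  contDiffAt_frame H.neg

theorem fderiv_frame (H : IsLocalData h u A p.1) (X Z : W × ℝ) :
    fderiv ℝ (frame A) p X Z = (0, fderiv ℝ A p.1 X.1 Z.1) := by
  have h0 := hasDerivAt_line_apply ((contDiffAt_frame H).differentiableAt (by simp)) X Z
  have h1 := (hasDerivAt_const (0 : ℝ) Z.1).prodMk
    ((hasDerivAt_line_apply H.diff_A X.1 Z.1).const_add Z.2)
  exact h0.unique h1

/-- Horizontal part of the connection form in the frame. -/
def horPart (h : W → W →L[ℝ] W →L[ℝ] ℝ) (u : W → ℝ) (A : W → W →L[ℝ] ℝ) (y x : W) (ρ : ℝ)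
    (z : W) (ζ : ℝ) : W :=
  christoffel h y x z + (1 / 2 * (u y)⁻¹) • (fderiv ℝ u y x • z + fderiv ℝ u y z • x -
      h y x z • grad h u y) +
    (1 / 2 * (u y)⁻¹ ^ 2) • (ρ • curlOp h A y z + ζ • curlOp h A y x) +
    (1 / 2 * (u y)⁻¹ ^ 3 * (ρ * ζ)) • grad h u y

/-- Vertical part of the connection form in the frame. -/
def verPart (u : W → ℝ) (A : W → W →L[ℝ] ℝ) (y x : W) (ρ : ℝ) (z : W) (ζ : ℝ) : ℝ :=
  -(1 / 2 * curl A y x z) - 1 / 2 * (u y)⁻¹ * (fderiv ℝ u y x * ζ + fderiv ℝ u y z * ρ)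

variable [FiniteDimensional ℝ W]

theorem inner_grad (hB : IsInnerForm (h y)) (w : W) : h y (grad h u y) w = fderiv ℝ u y w :=
  hB.inverse_apply _ _

theorem inner_curlOp (hB : IsInnerForm (h y)) (v w : W) : h y (curlOp h A y v) w = curl A y v w :=
  hB.inverse_apply _ _

/-- By nondegeneracy it suffices to pair the proposed vector with an arbitrary Y and compare with
the Christoffel symbol of the first kind. The summand ∂_X A(Z) is the inhomogeneous term caused by
the dependence of the frame on the point. -/
theorem christoffel_coordMetric (H : IsLocalData h u A p.1) (X Z : W × ℝ) :
    christoffel (coordMetric h u A) p X Z = coframe A p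
      (horPart h u A p.1 X.1 (connForm A p X) Z.1 (connForm A p Z),
        verPart u A p.1 X.1 (connForm A p X) Z.1 (connForm A p Z) +
          fderiv ℝ A p.1 X.1 Z.1) := by
  have hB := H.inner.self_of_nhds
  have hu := H.pos.self_of_nhds
  refine christoffel_eq (isInnerForm_coordMetric hB hu) fun Y => ?_
  rw [coordMetric_apply, connForm_coframe, christoffelLower_apply, fderiv_coordMetric H,
    fderiv_coordMetric H, fderiv_coordMetric H, horPart, verPart, coframe_apply]
  have e1 := inner_christoffel hB X.1 Z.1 Y.1
  rw [christoffelLower_apply] at e1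
  simp only [map_add, map_sub, map_smul, add_apply, sub_apply, smul_apply, smul_eq_mul, e1,
    inner_grad hB, inner_curlOp hB, curl_apply]
  field_simp
  ring

/-- The term (∂_X P) P⁻¹ of the gauge transform cancels the summand ∂_X A(Z) of
`christoffel_coordMetric`; derivatives of A survive only through dA. -/
theorem gauge_coordMetric (H : IsLocalData h u A p.1) (X Z : W × ℝ) :
    gauge (christoffel (coordMetric h u A)) (frame A) (coframe A) p X Z =
      (horPart h u A p.1 X.1 (connForm A p X) Z.1 Z.2,
        verPart u A p.1 X.1 (connForm A p X) Z.1 Z.2) := by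
  rw [gauge_apply, christoffel_coordMetric H, frame_coframe, fderiv_frame H, connForm_coframe]
  have : (coframe A p Z).1 = Z.1 := by rw [coframe_apply]
  rw [this]
  simp

end LocalMetric

/-! ### Traces on W × ℝ. -/

section Trace

theorem trace_prod_eq_sum {W : Type*} [AddCommGroup W] [Module ℝ W]
    {ι : Type*} [Fintype ι] [DecidableEq ι] (e : Module.Basis ι ℝ W)
    (T : W × ℝ →ₗ[ℝ] W × ℝ) :
    LinearMap.trace ℝ _ T = (∑ i, e.repr (T (e i, 0)).1 i) + (T (0, 1)).2 := by
  rw [LinearMap.trace_eq_matrix_trace ℝ (e.prod (Module.Basis.singleton Unit ℝ)), Matrix.trace,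
    Fintype.sum_sum_type]
  simp [LinearMap.toMatrix_apply]

theorem trace_conj_prod_eq_sum {W : Type*} [AddCommGroup W] [Module ℝ W]
    {ι : Type*} [Fintype ι] [DecidableEq ι] (e : Module.Basis ι ℝ W)
    (T P Q : W × ℝ →ₗ[ℝ] W × ℝ) (h : ∀ X, P (Q X) = X) (h' : ∀ X, Q (P X) = X) :
    LinearMap.trace ℝ _ T =
      (∑ i, e.repr (P (T (Q (e i, 0)))).1 i) + (P (T (Q (0, 1)))).2 := by
  rw [← LinearMap.trace_conj' T (LinearEquiv.ofLinearMap P Q (LinearMap.ext h) (LinearMap.ext h')),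
    trace_prod_eq_sum e]
  rfl

end Trace


/-! ### The difference of the two connections and its covariant derivative. -/

section DifferenceTensor

variable {W : Type*} [NormedAddCommGroup W] [NormedSpace ℝ W]

/-- Horizontal part of the difference of the Levi-Civita connections of `u h + u⁻¹ θ²` and `h`, in
terms of `c = u⁻¹`, the gradient `q` of `u` and the skew endomorphism `J` given by `dθ`. -/
def tauHor (B : W →L[ℝ] W →L[ℝ] ℝ) (c : ℝ) (q : W) (J : W →L[ℝ] W) (x : W) (ρ : ℝ) (z : W)
    (ζ : ℝ) : W :=
  (1 / 2 * c) • (B q x • z + B q z • x - B x z • q) +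
    (1 / 2 * c ^ 2) • (ρ • J z + ζ • J x) + (1 / 2 * c ^ 3 * (ρ * ζ)) • q

/-- Vertical part of the difference of the Levi-Civita connections. -/
def tauVer (B : W →L[ℝ] W →L[ℝ] ℝ) (c : ℝ) (q : W) (J : W →L[ℝ] W) (x : W) (ρ : ℝ) (z : W)
    (ζ : ℝ) : ℝ :=
  -(1 / 2 * B (J x) z) - 1 / 2 * c * (B q x * ζ + B q z * ρ)

/-- Covariant derivative of `tauHor`; `S` and `DJ` are the covariant derivatives of `q`, `J`. -/
def dTauHor (B : W →L[ℝ] W →L[ℝ] ℝ) (c : ℝ) (q : W) (J : W →L[ℝ] W) (S : W → W) (DJ : W → W → W)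
    (x y : W) (η : ℝ) (z : W) (ζ : ℝ) : W :=
  (-(1 / 2 * c ^ 2 * B q x)) • (B q y • z + B q z • y - B y z • q) +
    (1 / 2 * c) • (B (S x) y • z + B (S x) z • y - B y z • S x) -
    (c ^ 3 * B q x) • (η • J z + ζ • J y) + (1 / 2 * c ^ 2) • (η • DJ x z + ζ • DJ x y) -
    (3 / 2 * c ^ 4 * B q x * (η * ζ)) • q + (1 / 2 * c ^ 3 * (η * ζ)) • S x

/-- Covariant derivative of `tauVer`. -/
def dTauVer (B : W →L[ℝ] W →L[ℝ] ℝ) (c : ℝ) (q : W) (S : W → W) (DJ : W → W → W)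
    (x y : W) (η : ℝ) (z : W) (ζ : ℝ) : ℝ :=
  -(1 / 2 * B (DJ x y) z) + 1 / 2 * c ^ 2 * B q x * (B q y * ζ + B q z * η) -
    1 / 2 * c * (B (S x) y * ζ + B (S x) z * η)

/-- Horizontal part of the difference of the curvatures. -/
def curvHor (B : W →L[ℝ] W →L[ℝ] ℝ) (c : ℝ) (q : W) (J : W →L[ℝ] W) (S : W → W) (DJ : W → W → W)
    (x : W) (ρ : ℝ) (y : W) (η : ℝ) (z : W) (ζ : ℝ) : W :=
  dTauHor B c q J S DJ x y η z ζ - dTauHor B c q J S DJ y x ρ z ζ +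
    (1 / 2 * c ^ 2 * B (J x) y) • J z + (1 / 2 * c ^ 3 * B (J x) y * ζ) • q +
    tauHor B c q J x ρ (tauHor B c q J y η z ζ) (tauVer B c q J y η z ζ) -
    tauHor B c q J y η (tauHor B c q J x ρ z ζ) (tauVer B c q J x ρ z ζ)

/-- Vertical part of the difference of the curvatures. -/
def curvVer (B : W →L[ℝ] W →L[ℝ] ℝ) (c : ℝ) (q : W) (J : W →L[ℝ] W) (S : W → W) (DJ : W → W → W)
    (x : W) (ρ : ℝ) (y : W) (η : ℝ) (z : W) (ζ : ℝ) : ℝ :=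
  dTauVer B c q S DJ x y η z ζ - dTauVer B c q S DJ y x ρ z ζ -
    1 / 2 * c * B q z * B (J x) y +
    tauVer B c q J x ρ (tauHor B c q J y η z ζ) (tauVer B c q J y η z ζ) -
    tauVer B c q J y η (tauHor B c q J x ρ z ζ) (tauVer B c q J x ρ z ζ)

variable {h : W → W →L[ℝ] W →L[ℝ] ℝ} {u : W → ℝ} {A : W → W →L[ℝ] ℝ} {y₀ : W} {p : W × ℝ}

/-- The covariant Hessian of `u`, as an endomorphism. -/
def hess (h : W → W →L[ℝ] W →L[ℝ] ℝ) (u : W → ℝ) (y x : W) : W :=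
  fderiv ℝ (grad h u) y x + christoffel h y x (grad h u y)

/-- The covariant derivative of `curlOp`. -/
def covCurl (h : W → W →L[ℝ] W →L[ℝ] ℝ) (A : W → W →L[ℝ] ℝ) (y x v : W) : W :=
  fderiv ℝ (curlOp h A) y x v + christoffel h y x (curlOp h A y v) -
    curlOp h A y (christoffel h y x v)

theorem contDiffAt_curl (H : IsLocalData h u A y₀) : ContDiffAt ℝ ∞ (curl A) y₀ := by
  have h1 : ContDiffAt ℝ ∞ (fderiv ℝ A) y₀ := H.smooth_A.self_of_nhds.fderiv_right (by simp)
  exact h1.sub ((ContinuousLinearMap.flipₗᵢ ℝ W W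
    ℝ).toContinuousLinearEquiv.contDiff.contDiffAt.comp y₀ h1)

variable [FiniteDimensional ℝ W]

theorem contDiffAt_grad (H : IsLocalData h u A y₀) : ContDiffAt ℝ ∞ (grad h u) y₀ :=
  (contDiffAt_inverse H.smooth_h.self_of_nhds H.inner.self_of_nhds).clm_apply
    (H.smooth_u.self_of_nhds.fderiv_right (by simp))

theorem contDiffAt_curlOp (H : IsLocalData h u A y₀) : ContDiffAt ℝ ∞ (curlOp h A) y₀ :=
  (contDiffAt_inverse H.smooth_h.self_of_nhds H.inner.self_of_nhds).clm_comp (contDiffAt_curl H)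

theorem eventually_line {E : Type*} [NormedAddCommGroup E] [NormedSpace ℝ E] {P : E → Prop} {p : E}
    (H : ∀ᶠ z in 𝓝 p, P z) (X : E) : ∀ᶠ s : ℝ in 𝓝 0, P (p + s • X) := by
  have : Filter.Tendsto (fun s : ℝ => p + s • X) (𝓝 0) (𝓝 (p + (0 : ℝ) • X)) :=
    Continuous.tendsto (by fun_prop) 0
  rw [zero_smul, add_zero] at this
  exact this.eventually H

/-- Differentiate h(grad u, v) = du(v) along x and apply metric compatibility. -/
theorem fderiv_fderiv_eq_hess (H : IsLocalData h u A y₀) (x v : W) :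
    fderiv ℝ (fderiv ℝ u) y₀ x v =
      h y₀ (hess h u y₀ x) v + h y₀ (grad h u y₀) (christoffel h y₀ x v) := by
  have h1 : ContDiffAt ℝ ∞ (fderiv ℝ u) y₀ := H.smooth_u.self_of_nhds.fderiv_right (by simp)
  have d1 := hasDerivAt_line_apply (h1.differentiableAt (by simp)) x v
  have dq := hasDerivAt_line ((contDiffAt_grad H).differentiableAt (by simp)) x
  have dh := ((hasDerivAt_line H.diff_h x).clm_apply dq).clm_apply (hasDerivAt_const 0 v)
  have e := (dh.congr_of_eventuallyEq (eventually_line (H.inner.mono fun z hz =>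
    (inner_grad (u := u) hz v).symm) x)).unique d1
  rw [← e]
  simp only [zero_smul, add_zero, hess, map_add, add_apply, map_zero]
  rw [fderiv_eq_christoffel H.diff_h H.inner]
  ring

/-- As for the Hessian, starting from h(J v, w) = dA(v, w). -/
theorem fderiv_curl_eq_covCurl (H : IsLocalData h u A y₀) (x v w : W) :
    fderiv ℝ (curl A) y₀ x v w = h y₀ (covCurl h A y₀ x v) w +
      h y₀ (curlOp h A y₀ (christoffel h y₀ x v)) w +
      h y₀ (curlOp h A y₀ v) (christoffel h y₀ x w) := by
  have d1 := hasDerivAt_line_apply_apply ((contDiffAt_curl H).differentiableAt (by simp)) x v w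
  have dq := hasDerivAt_line_apply ((contDiffAt_curlOp H).differentiableAt (by simp)) x v
  have dh := ((hasDerivAt_line H.diff_h x).clm_apply dq).clm_apply (hasDerivAt_const 0 w)
  have e := (dh.congr_of_eventuallyEq (eventually_line (H.inner.mono fun z hz =>
    (inner_curlOp (A := A) hz v w).symm) x)).unique d1
  rw [← e]
  simp only [zero_smul, add_zero, covCurl, map_add, map_sub, add_apply, sub_apply, map_zero]
  rw [fderiv_eq_christoffel H.diff_h H.inner]
  ring

theorem horPart_eq (hB : IsInnerForm (h y₀)) (x : W) (ρ : ℝ) (z : W) (ζ : ℝ) :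
    horPart h u A y₀ x ρ z ζ = christoffel h y₀ x z +
      tauHor (h y₀) (u y₀)⁻¹ (grad h u y₀) (curlOp h A y₀) x ρ z ζ := by
  simp only [horPart, tauHor, inner_grad hB, add_assoc]

theorem verPart_eq (hB : IsInnerForm (h y₀)) (x : W) (ρ : ℝ) (z : W) (ζ : ℝ) :
    verPart u A y₀ x ρ z ζ =
      tauVer (h y₀) (u y₀)⁻¹ (grad h u y₀) (curlOp h A y₀) x ρ z ζ := by
  simp only [verPart, tauVer, inner_grad hB, inner_curlOp hB]

/-- The Leibniz rule: the coordinate derivative of a tensor is its covariant derivative plus a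
Christoffel correction in each slot. The additional ∂_x A(y) term arises because the θ-component r +
A(y) of a constant vector (y, r) varies with the base point. -/
theorem hasDerivAt_verPart (H : IsLocalData h u A y₀) (x y z : W) (r ζ : ℝ) :
    HasDerivAt (fun s : ℝ => verPart u A (y₀ + s • x) y (r + A (y₀ + s • x) y) z ζ)
      (dTauVer (h y₀) (u y₀)⁻¹ (grad h u y₀) (hess h u y₀) (covCurl h A y₀) x y (r + A y₀ y) z ζ -
        1 / 2 * (u y₀)⁻¹ * h y₀ (grad h u y₀) z * fderiv ℝ A y₀ x y +
        tauVer (h y₀) (u y₀)⁻¹ (grad h u y₀) (curlOp h A y₀) (christoffel h y₀ x y)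
          0 z ζ +
        tauVer (h y₀) (u y₀)⁻¹ (grad h u y₀) (curlOp h A y₀) y (r + A y₀ y)
          (christoffel h y₀ x z) 0) 0 := by
  have hB := H.inner.self_of_nhds
  have h1 : ContDiffAt ℝ ∞ (fderiv ℝ u) y₀ := H.smooth_u.self_of_nhds.fderiv_right (by simp)
  have ddu := hasDerivAt_line_apply (h1.differentiableAt (by simp)) x
  have dK := hasDerivAt_line_apply_apply ((contDiffAt_curl H).differentiableAt (by simp)) x y z
  have dA := (hasDerivAt_line_apply H.diff_A x y).const_add r
  have hne : u (y₀ + (0 : ℝ) • x) ≠ 0 := by simpa using H.pos.self_of_nhds.ne'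
  have dc := (hasDerivAt_line H.diff_u x).inv hne
  have := (dK.const_mul (1 / 2)).neg.sub ((dc.const_mul (1 / 2)).mul
    (((ddu y).mul_const ζ).add ((ddu z).mul dA)))
  refine this.congr_deriv ?_
  simp only [zero_smul, add_zero, fderiv_fderiv_eq_hess H, fderiv_curl_eq_covCurl H, dTauVer,
    tauVer, ← inner_grad hB, Pi.add_apply, Pi.mul_apply, Pi.inv_apply]
  ring

/-- The same Leibniz rule. The value is now a vector, which adds a correction by -Γ(x, ·), and the
derivative of the Christoffel symbol of h enters the curvature of the base. -/
theorem hasDerivAt_horPart (H : IsLocalData h u A y₀) (x y z : W) (r ζ : ℝ) :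
    HasDerivAt (fun s : ℝ => horPart h u A (y₀ + s • x) y (r + A (y₀ + s • x) y) z ζ)
      (fderiv ℝ (christoffel h) y₀ x y z +
        dTauHor (h y₀) (u y₀)⁻¹ (grad h u y₀) (curlOp h A y₀) (hess h u y₀) (covCurl h A y₀) x y
          (r + A y₀ y) z ζ +
        (1 / 2 * (u y₀)⁻¹ ^ 2 * fderiv ℝ A y₀ x y) • curlOp h A y₀ z +
        (1 / 2 * (u y₀)⁻¹ ^ 3 * fderiv ℝ A y₀ x y * ζ) • grad h u y₀ -
        christoffel h y₀ x (tauHor (h y₀) (u y₀)⁻¹ (grad h u y₀) (curlOp h A y₀)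
          y (r + A y₀ y) z ζ) +
        tauHor (h y₀) (u y₀)⁻¹ (grad h u y₀) (curlOp h A y₀) (christoffel h y₀ x y)
          0 z ζ +
        tauHor (h y₀) (u y₀)⁻¹ (grad h u y₀) (curlOp h A y₀) y (r + A y₀ y)
          (christoffel h y₀ x z) 0) 0 := by
  have hB := H.inner.self_of_nhds
  have h1 : ContDiffAt ℝ ∞ (fderiv ℝ u) y₀ := H.smooth_u.self_of_nhds.fderiv_right (by simp)
  have ddu := hasDerivAt_line_apply (h1.differentiableAt (by simp)) x
  have dJ := hasDerivAt_line_apply ((contDiffAt_curlOp H).differentiableAt (by simp)) x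
  have dA := (hasDerivAt_line_apply H.diff_A x y).const_add r
  have hne : u (y₀ + (0 : ℝ) • x) ≠ 0 := by simpa using H.pos.self_of_nhds.ne'
  have dc := (hasDerivAt_line H.diff_u x).inv hne
  have dq := hasDerivAt_line ((contDiffAt_grad H).differentiableAt (by simp)) x
  have dh := hasDerivAt_line_apply_apply H.diff_h x y z
  have dΓ := hasDerivAt_line_apply_apply
    ((contDiffAt_christoffel H.smooth_h.self_of_nhds hB).differentiableAt (by simp)) x y z
  have := ((dΓ.add ((dc.const_mul (1 / 2)).smul
    ((((ddu y).smul_const z).add ((ddu z).smul_const y)).sub (dh.smul dq)))).add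
    (((dc.pow 2).const_mul (1 / 2)).smul ((dA.smul (dJ z)).add ((dJ y).const_smul ζ)))).add
    ((((dc.pow 3).const_mul (1 / 2)).mul (dA.mul_const ζ)).smul dq)
  refine this.congr_deriv ?_
  have eq : fderiv ℝ (grad h u) y₀ x = hess h u y₀ x - christoffel h y₀ x (grad h u y₀) := by
    simp [hess]
  have eJ : ∀ v, fderiv ℝ (curlOp h A) y₀ x v = covCurl h A y₀ x v -
      christoffel h y₀ x (curlOp h A y₀ v) + curlOp h A y₀ (christoffel h y₀ x v) := by
    intro v; simp only [covCurl]; abel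
  simp only [zero_smul, add_zero, fderiv_fderiv_eq_hess H, fderiv_eq_christoffel H.diff_h H.inner,
    eq, eJ, dTauHor,
    tauHor, ← inner_grad hB, Pi.add_apply, Pi.mul_apply, Pi.sub_apply, Pi.smul_apply,
    Pi.smul_apply', Pi.pow_apply, Pi.inv_apply, map_add, map_sub, map_smul, mul_zero, zero_add,
    Nat.cast_ofNat, Nat.add_one_sub_one, pow_one]
  -- What remains is linear algebra over the scalars, so the Hessian and ∇J are made opaque for
  -- `module`.
  generalize hh : hess h u y₀ = S
  generalize covCurl h A y₀ = DJ
  module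

end DifferenceTensor


/-! ### The algebraic identity that kills the extra Ricci term. -/

section Curvature

variable {W : Type*} [NormedAddCommGroup W] [NormedSpace ℝ W]

theorem tauHor_add (B : W →L[ℝ] W →L[ℝ] ℝ) (c : ℝ) (q : W) (J : W →L[ℝ] W) (x : W) (ρ : ℝ)
    (z z' : W) (ζ : ℝ) : tauHor B c q J x ρ (z + z') ζ =
      tauHor B c q J x ρ z 0 + tauHor B c q J x ρ z' ζ := by
  simp only [tauHor, map_add]
  module

theorem tauVer_add (B : W →L[ℝ] W →L[ℝ] ℝ) (c : ℝ) (q : W) (J : W →L[ℝ] W) (x : W) (ρ : ℝ)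
    (z z' : W) (ζ : ℝ) : tauVer B c q J x ρ (z + z') ζ =
      tauVer B c q J x ρ z 0 + tauVer B c q J x ρ z' ζ := by
  simp only [tauVer, map_add]
  ring

/-- The contribution of the difference tensor to the Ricci curvature vanishes if `J` is the cross
product with `q`, the same holds for the derivatives, and the Hessian is trace-free. -/
theorem trace_curvHor_add_curvVer {B : W →L[ℝ] W →L[ℝ] ℝ} {c : ℝ} {q : W} {J : W →L[ℝ] W}
    {S : W → W} {DJ : W → W → W} (e : Fin 3 → W) (k : Fin 3 → W →ₗ[ℝ] ℝ)
    (hB : ∀ v w, B v w = k 0 v * k 0 w + k 1 v * k 1 w + k 2 v * k 2 w)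
    (he : ∀ i j, k i (e j) = if i = j then 1 else 0)
    (hJ : ∀ v i, k i (J v) = k (i + 1) q * k (i + 2) v - k (i + 2) q * k (i + 1) v)
    (hDJ : ∀ x v i, k i (DJ x v) = k (i + 1) (S x) * k (i + 2) v - k (i + 2) (S x) * k (i + 1) v)
    (m : Fin 3 → Fin 3 → ℝ) (hS : ∀ x i, k i (S x) = k 0 x * m 0 i + k 1 x * m 1 i + k 2 x * m 2 i)
    (hm : ∀ i j, m i j = m j i) (htr : m 0 0 + m 1 1 + m 2 2 = 0)
    (y : W) (η : ℝ) (z : W) (ζ : ℝ) :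
    (∑ i, k i (curvHor B c q J S DJ (e i) 0 y η z ζ)) + curvVer B c q J S DJ 0 1 y η z ζ = 0 := by
  have h10 := hm 1 0
  have h20 := hm 2 0
  have h21 := hm 2 1
  -- The trace condition is used by eliminating one diagonal entry. Once everything is expanded in
  -- coordinates of `e`, the claim is a polynomial identity.
  have h22 : m 2 2 = - m 0 0 - m 1 1 := by linarith
  have e1 : (1 : Fin 3) + 1 = 2 := rfl
  have e2 : (1 : Fin 3) + 2 = 0 := rfl
  have e3 : (2 : Fin 3) + 1 = 0 := rfl
  have e4 : (2 : Fin 3) + 2 = 1 := rfl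
  have n1 : ((0 : Fin 3) = 1) = False := by simp
  have n2 : ((0 : Fin 3) = 2) = False := by simp
  have n3 : ((1 : Fin 3) = 2) = False := by simp
  have n4 : ((1 : Fin 3) = 0) = False := by simp
  have n5 : ((2 : Fin 3) = 0) = False := by simp
  have n6 : ((2 : Fin 3) = 1) = False := by simp
  simp only [Fin.sum_univ_three, curvHor, curvVer, dTauHor, dTauVer, tauHor, tauVer, map_add,
    map_sub, map_smul, hB, hJ, hDJ, hS, he, h10, h20, h21, h22, map_zero, smul_eq_mul, zero_add, e1,
    e2, e3, e4, n1, n2, n3, n4, n5, n6, if_true, if_false, mul_zero, zero_mul, add_zero, sub_zero,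
    zero_sub, mul_one, one_mul, smul_zero, zero_apply]
  ring

end Curvature

/-! ### Curvature and Ricci tensor of the total space. -/

section Ricci

variable {W : Type*} [NormedAddCommGroup W] [NormedSpace ℝ W] [FiniteDimensional ℝ W]
variable {h : W → W →L[ℝ] W →L[ℝ] ℝ} {u : W → ℝ} {A : W → W →L[ℝ] ℝ} {y₀ : W} {p : W × ℝ}

theorem fderiv_gauge_coordMetric (H : IsLocalData h u A p.1) (X Y Z : W × ℝ) :
    (fderiv ℝ (gauge (christoffel (coordMetric h u A)) (frame A) (coframe A)) p X Y Z) =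
      (fderiv ℝ (christoffel h) p.1 X.1 Y.1 Z.1 +
        dTauHor (h p.1) (u p.1)⁻¹ (grad h u p.1) (curlOp h A p.1) (hess h u p.1) (covCurl h A p.1)
          X.1 Y.1 (connForm A p Y) Z.1 Z.2 +
        (1 / 2 * (u p.1)⁻¹ ^ 2 * fderiv ℝ A p.1 X.1 Y.1) • curlOp h A p.1 Z.1 +
        (1 / 2 * (u p.1)⁻¹ ^ 3 * fderiv ℝ A p.1 X.1 Y.1 * Z.2) • grad h u p.1 -
        christoffel h p.1 X.1 (tauHor (h p.1) (u p.1)⁻¹ (grad h u p.1) (curlOp h A p.1)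
          Y.1 (connForm A p Y) Z.1 Z.2) +
        tauHor (h p.1) (u p.1)⁻¹ (grad h u p.1) (curlOp h A p.1) (christoffel h p.1 X.1 Y.1)
          0 Z.1 Z.2 +
        tauHor (h p.1) (u p.1)⁻¹ (grad h u p.1) (curlOp h A p.1) Y.1 (connForm A p Y)
          (christoffel h p.1 X.1 Z.1) 0,
      dTauVer (h p.1) (u p.1)⁻¹ (grad h u p.1) (hess h u p.1) (covCurl h A p.1) X.1 Y.1
          (connForm A p Y) Z.1 Z.2 -
        1 / 2 * (u p.1)⁻¹ * h p.1 (grad h u p.1) Z.1 * fderiv ℝ A p.1 X.1 Y.1 +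
        tauVer (h p.1) (u p.1)⁻¹ (grad h u p.1) (curlOp h A p.1) (christoffel h p.1 X.1 Y.1)
          0 Z.1 Z.2 +
        tauVer (h p.1) (u p.1)⁻¹ (grad h u p.1) (curlOp h A p.1) Y.1 (connForm A p Y)
          (christoffel h p.1 X.1 Z.1) 0) := by
  have d1 := hasDerivAt_line_apply_apply (differentiableAt_gauge
    ((contDiffAt_christoffel (contDiffAt_coordMetric H) (isInnerForm_coordMetric
      H.inner.self_of_nhds H.pos.self_of_nhds)).differentiableAt (by simp)) (contDiffAt_frame H)
    ((contDiffAt_coframe H).differentiableAt (by simp))) X Y Z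
  have d2 := (hasDerivAt_horPart H X.1 Y.1 Z.1 Y.2 Z.2).prodMk
    (hasDerivAt_verPart H X.1 Y.1 Z.1 Y.2 Z.2)
  refine d1.unique (d2.congr_of_eventuallyEq ?_)
  filter_upwards [eventually_line (eventually_fst H.eventually) X] with s hs
  exact gauge_coordMetric hs Y Z

/-- Antisymmetrising in X and Y removes all Christoffel corrections: those in the slots of X and Y
cancel by symmetry of Γ, the others against the products of Γ with the difference tensor. The
leftover ∂A terms combine into dA(X, Y). -/
theorem frame_curvatureMap (H : IsLocalData h u A p.1) (X Y Z : W × ℝ) :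
    frame A p (curvatureMap (coordMetric h u A) p Y Z X) =
      (curvatureMap h p.1 Y.1 Z.1 X.1 + curvHor (h p.1) (u p.1)⁻¹ (grad h u p.1) (curlOp h A p.1)
          (hess h u p.1) (covCurl h A p.1) X.1 (connForm A p X) Y.1 (connForm A p Y) Z.1
          (connForm A p Z),
        curvVer (h p.1) (u p.1)⁻¹ (grad h u p.1) (curlOp h A p.1)
          (hess h u p.1) (covCurl h A p.1) X.1 (connForm A p X) Y.1 (connForm A p Y) Z.1
          (connForm A p Z)) := by
  have hB := H.inner.self_of_nhds
  have hΓ := (contDiffAt_christoffel (contDiffAt_coordMetric H) (isInnerForm_coordMetric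
      H.inner.self_of_nhds H.pos.self_of_nhds)).differentiableAt (by simp)
  rw [curvatureMap_apply, curvature_gauge hΓ (contDiffAt_frame H)
    ((contDiffAt_coframe H).differentiableAt (by simp))
    (Filter.Eventually.of_forall fun z Z => coframe_frame A z Z),
    fderiv_gauge_coordMetric H, fderiv_gauge_coordMetric H, gauge_coordMetric H,
    gauge_coordMetric H, gauge_coordMetric H, gauge_coordMetric H, curvatureMap_apply]
  have hf : frame A p Z = (Z.1, connForm A p Z) := rfl
  rw [hf]
  simp only [horPart_eq hB, verPart_eq hB, tauHor_add, tauVer_add, Prod.mk_add_mk, Prod.mk_sub_mk,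
    curvHor, curvVer]
  have hs := christoffel_symm H.diff_h H.inner Y.1 X.1
  have hK : h p.1 (curlOp h A p.1 X.1) Y.1 = fderiv ℝ A p.1 X.1 Y.1 - fderiv ℝ A p.1 Y.1 X.1 := by
    rw [inner_curlOp hB, curl_apply]
  rw [hs, hK]
  refine Prod.ext ?_ ?_
  · simp only [map_add]
    module
  · simp only
    ring

/-- The trace is invariant under conjugation by the frame, so it is taken over (e i, 0) and (0, 1).
The base summand gives the Ricci tensor of h, and the rest is zero by `trace_curvHor_add_curvVer`.
-/
theorem coordRicci_coordMetric (H : IsLocalData h u A p.1) (e : Module.Basis (Fin 3) ℝ W)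
    (he : ∀ i j, h p.1 (e i) (e j) = if i = j then 1 else 0)
    (hJ : ∀ v i, e.coord i (curlOp h A p.1 v) = e.coord (i + 1) (grad h u p.1) * e.coord (i + 2) v -
      e.coord (i + 2) (grad h u p.1) * e.coord (i + 1) v)
    (hDJ : ∀ x v i, e.coord i (covCurl h A p.1 x v) =
      e.coord (i + 1) (hess h u p.1 x) * e.coord (i + 2) v -
      e.coord (i + 2) (hess h u p.1 x) * e.coord (i + 1) v)
    (htr : ∑ i, e.coord i (hess h u p.1 (e i)) = 0) (v w : W × ℝ) :
    coordRicci (coordMetric h u A) p v w = coordRicci h p.1 v.1 w.1 := by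
  have hB := H.inner.self_of_nhds
  have hcoord : ∀ v i, e.coord i v = h p.1 v (e i) := by
    intro v i
    conv_rhs => rw [← e.sum_repr v, Fin.sum_univ_three]
    simp only [map_add, map_smul, add_apply, smul_apply, he, smul_eq_mul]
    fin_cases i <;> simp
  have hexp : ∀ v w, h p.1 v w = e.coord 0 v * e.coord 0 w + e.coord 1 v * e.coord 1 w +
      e.coord 2 v * e.coord 2 w := by
    intro v w
    conv_lhs => rw [← e.sum_repr w, Fin.sum_univ_three]
    simp only [map_add, map_smul, ← hcoord, smul_eq_mul, Module.Basis.coord_apply]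
    ring
  have hlin : ∀ x i, e.coord i (hess h u p.1 x) = e.coord 0 x * e.coord i (hess h u p.1 (e 0)) +
      e.coord 1 x * e.coord i (hess h u p.1 (e 1)) +
      e.coord 2 x * e.coord i (hess h u p.1 (e 2)) := by
    intro x i
    have : ∀ x, hess h u p.1 x = (fderiv ℝ (grad h u) p.1 +
      (christoffel h p.1).flip (grad h u p.1)) x := fun x => rfl
    simp only [this]
    conv_lhs => rw [← e.sum_repr x]
    simp only [map_smul, Fin.sum_univ_three, smul_eq_mul, map_add, Module.Basis.coord_apply]
  -- Symmetry of the covariant Hessian: second derivatives of u commute and Γ is symmetric.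
  have hsym : ∀ i j, e.coord j (hess h u p.1 (e i)) = e.coord i (hess h u p.1 (e j)) := by
    intro i j
    rw [hcoord, hcoord]
    have e1 := fderiv_fderiv_eq_hess H (e i) (e j)
    have e2 := fderiv_fderiv_eq_hess H (e j) (e i)
    have e3 : fderiv ℝ (fderiv ℝ u) p.1 (e i) (e j) = fderiv ℝ (fderiv ℝ u) p.1 (e j) (e i) :=
      H.smooth_u.self_of_nhds.isSymmSndFDerivAt (by
        simpa using (WithTop.coe_le_coe.2 le_top : ((2 : ℕ∞) : ℕ∞ω) ≤ ∞)) _ _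
    rw [christoffel_symm H.diff_h H.inner] at e1
    linarith
  have key := trace_curvHor_add_curvVer (c := (u p.1)⁻¹) (q := grad h u p.1) (J := curlOp h A p.1)
    (S := hess h u p.1) (DJ := covCurl h A p.1) e e.coord hexp
    (fun i j => by simp [Finsupp.single_apply, eq_comm]) hJ hDJ
    (fun i j => e.coord j (hess h u p.1 (e i))) hlin hsym (by simpa [Fin.sum_univ_three] using htr)
    v.1 (connForm A p v) w.1 (connForm A p w)
  rw [coordRicci, trace_conj_prod_eq_sum e _ (frame A p : W × ℝ →ₗ[ℝ] W × ℝ) (coframe A p)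
    (frame_coframe A p) (coframe_frame A p)]
  simp only [ContinuousLinearMap.coe_coe, frame_curvatureMap H, connForm_coframe]
  simp only [coframe_apply, map_zero]
  rw [coordRicci, LinearMap.trace_eq_matrix_trace ℝ e, Matrix.trace]
  simp only [Matrix.diag, LinearMap.toMatrix_apply, map_add, Finsupp.add_apply,
    Finset.sum_add_distrib]
  simp only [Module.Basis.coord_apply] at key
  rw [add_assoc, key, add_zero]
  rfl

end Ricci


/-! ### Oriented orthonormal bases, the Hodge star and the volume form. -/

section OrthonormalBases

variable {W : Type*} [NormedAddCommGroup W] [NormedSpace ℝ W]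

/-- An orthogonal basis is rescaled to unit length and then adjusted to the orientation; the
adjustment changes vectors by signs only, so orthonormality survives. -/
theorem IsInnerForm.exists_isPosOrthonormal {B : W →L[ℝ] W →L[ℝ] ℝ} (hB : IsInnerForm B)
    (hW : Module.finrank ℝ W = 3) (o : Orientation ℝ W (Fin 3)) :
    ∃ e : Module.Basis (Fin 3) ℝ W, IsPosOrthonormal B o e := by
  have : FiniteDimensional ℝ W := Module.finite_of_finrank_pos (by omega)
  let b : LinearMap.BilinForm ℝ W := LinearMap.mk₂ ℝ (fun v w => B v w) (by simp) (by simp)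
    (by simp) (by simp)
  have hb : ∀ v w, b v w = B v w := fun v w => rfl
  obtain ⟨v₀, hv₀⟩ := LinearMap.BilinForm.exists_orthogonal_basis (B := b)
    (⟨fun v w => hB.symm v w⟩)
  let v := v₀.reindex (finCongr hW)
  have hv : ∀ i j, i ≠ j → B (v i) (v j) = 0 := by
    intro i j hij
    have := hv₀ (i := (finCongr hW).symm i) (j := (finCongr hW).symm j) (by simpa using hij)
    simpa [v, hb] using this
  have hpos : ∀ i, 0 < B (v i) (v i) := fun i => hB.pos _ (v.ne_zero i)
  let e₁ := v.unitsSMul fun i => Units.mk0 (Real.sqrt (B (v i) (v i)))⁻¹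
    (inv_ne_zero (Real.sqrt_ne_zero'.mpr (hpos i)))
  have he₁ : ∀ i, e₁ i = (Real.sqrt (B (v i) (v i)))⁻¹ • v i := fun i => by
    simp [e₁, Module.Basis.unitsSMul_apply, Units.smul_def]
  have hon : ∀ i j, B (e₁ i) (e₁ j) = if i = j then 1 else 0 := by
    intro i j
    rw [he₁, he₁]
    split_ifs with hij
    · subst hij
      have h1 := Real.mul_self_sqrt (hpos i).le
      have h2 := (Real.sqrt_ne_zero'.mpr (hpos i))
      simp only [map_smul, smul_apply, smul_eq_mul]
      field_simp
      rw [sq, h1]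
    · simp [hv i j hij]
  refine ⟨e₁.adjustToOrientation o, ?_, e₁.orientation_adjustToOrientation o⟩
  intro i j
  by_cases hij : i = j
  · subst hij
    rcases e₁.adjustToOrientation_apply_eq_or_eq_neg o i with h1 | h1 <;> rw [h1] <;> simp [hon]
  · rcases e₁.adjustToOrientation_apply_eq_or_eq_neg o i with h1 | h1 <;>
    rcases e₁.adjustToOrientation_apply_eq_or_eq_neg o j with h2 | h2 <;> rw [h1, h2] <;>
    simp [hon, hij]

/-- Coordinate of a vector in an orthonormal basis. -/
theorem coord_eq_inner {B : W →L[ℝ] W →L[ℝ] ℝ} {e : Module.Basis (Fin 3) ℝ W}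
    (he : ∀ i j, B (e i) (e j) = if i = j then 1 else 0) (v : W) (i : Fin 3) :
    e.coord i v = B v (e i) := by
  conv_rhs => rw [← e.sum_repr v, Fin.sum_univ_three]
  simp only [map_add, map_smul, add_apply, smul_apply, he, smul_eq_mul]
  fin_cases i <;> simp

theorem inner_eq_coord {B : W →L[ℝ] W →L[ℝ] ℝ} {e : Module.Basis (Fin 3) ℝ W}
    (he : ∀ i j, B (e i) (e j) = if i = j then 1 else 0) (v w : W) :
    B v w = ∑ i, e.coord i v * e.coord i w := by
  conv_lhs => rw [← e.sum_repr w, Fin.sum_univ_three]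
  simp only [map_add, map_smul, ← coord_eq_inner he, smul_eq_mul, Module.Basis.coord_apply,
    Fin.sum_univ_three]
  ring

/-- The determinant of three vectors in a basis. -/
def tripleDet (e : Module.Basis (Fin 3) ℝ W) (a b c : W) : ℝ :=
  e.coord 0 a * (e.coord 1 b * e.coord 2 c - e.coord 2 b * e.coord 1 c) -
    e.coord 1 a * (e.coord 0 b * e.coord 2 c - e.coord 2 b * e.coord 0 c) +
    e.coord 2 a * (e.coord 0 b * e.coord 1 c - e.coord 1 b * e.coord 0 c)

theorem tripleDet_eq_det (e : Module.Basis (Fin 3) ℝ W) (a b c : W) :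
    tripleDet e a b c = e.det ![a, b, c] := by
  simp [tripleDet, Module.Basis.det_apply, Matrix.det_fin_three, Module.Basis.toMatrix_apply]
  ring

theorem tripleDet_basis (e : Module.Basis (Fin 3) ℝ W) (a v : W) (i : Fin 3) :
    tripleDet e a v (e i) =
      e.coord (i + 1) a * e.coord (i + 2) v - e.coord (i + 2) a * e.coord (i + 1) v := by
  have e1 : (1 : Fin 3) + 1 = 2 := rfl
  have e2 : (1 : Fin 3) + 2 = 0 := rfl
  have e3 : (2 : Fin 3) + 1 = 0 := rfl
  have e4 : (2 : Fin 3) + 2 = 1 := rfl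
  fin_cases i <;> simp [tripleDet, e1, e2, e3, e4] <;> ring

/-- The equation α = *β means β = ι_q vol with q dual to α, and vol is the determinant in any
positive orthonormal basis. -/
theorem IsHodgeStar.eq_tripleDet {B : W →L[ℝ] W →L[ℝ] ℝ} {o : Orientation ℝ W (Fin 3)}
    {α : W →L[ℝ] ℝ} {β : W →L[ℝ] W →L[ℝ] ℝ} (H : IsHodgeStar B o α (fun v w => β v w))
    (hβ : ∀ v w, β v w = -β w v) {q : W} (hq : ∀ w, B q w = α w)
    {e : Module.Basis (Fin 3) ℝ W} (he : IsPosOrthonormal B o e) (v w : W) :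
    β v w = tripleDet e q v w := by
  have h0 := H e he 0
  have h1 := H e he 1
  have h2 := H e he 2
  have e1 : (1 : Fin 3) + 1 = 2 := rfl
  have e2 : (1 : Fin 3) + 2 = 0 := rfl
  have e3 : (2 : Fin 3) + 1 = 0 := rfl
  have e4 : (2 : Fin 3) + 2 = 1 := rfl
  simp only [zero_add, e1, e2, e3, e4, ← hq, ← coord_eq_inner he.1] at h0 h1 h2
  have hd : ∀ v, β v v = 0 := fun v => by linarith [hβ v v]
  have a1 : β (e 2) (e 1) = -e.coord 0 q := by rw [hβ, ← h0]
  have a2 : β (e 0) (e 2) = -e.coord 1 q := by rw [hβ, ← h1]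
  have a3 : β (e 1) (e 0) = -e.coord 2 q := by rw [hβ, ← h2]
  conv_lhs => rw [← e.sum_repr v, ← e.sum_repr w, Fin.sum_univ_three, Fin.sum_univ_three]
  simp only [map_add, map_smul, add_apply, smul_apply, smul_eq_mul, hd, ← h0, ← h1, ← h2, a1, a2,
    a3, tripleDet, Module.Basis.coord_apply]
  ring

/-- The Gram determinant of a basis. -/
def gram (B : W →L[ℝ] W →L[ℝ] ℝ) (e : Module.Basis (Fin 3) ℝ W) : ℝ :=
  (Matrix.of fun i j => B (e i) (e j)).det

theorem IsHodgeStar.eq_sqrt_gram_mul {B : W →L[ℝ] W →L[ℝ] ℝ} {o : Orientation ℝ W (Fin 3)}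
    (hB : IsInnerForm B) {α : W →L[ℝ] ℝ} {β : W →L[ℝ] W →L[ℝ] ℝ}
    (H : IsHodgeStar B o α (fun v w => β v w))
    (hβ : ∀ v w, β v w = -β w v) {q : W} (hq : ∀ w, B q w = α w)
    {e : Module.Basis (Fin 3) ℝ W} (he : e.orientation = o) (v w : W) :
    β v w = Real.sqrt (gram B e) * tripleDet e q v w := by
  obtain ⟨ε, hε⟩ := hB.exists_isPosOrthonormal
    (by rw [Module.finrank_eq_card_basis e, Fintype.card_fin]) o
  have hpos : 0 < ε.det e := (Module.Basis.orientation_eq_iff_det_pos _ _).mp (hε.2.trans he.symm)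
  -- The Gram matrix is PᵀP for P the matrix of `e` in the orthonormal basis ε. Equal orientations
  -- give det P > 0, so the square root of the Gram determinant is det P itself.
  have hgram : gram B e = ε.det e ^ 2 := by
    have : (Matrix.of fun i j => B (e i) (e j)) = (ε.toMatrix e).transpose * ε.toMatrix e := by
      ext i j
      simp [Matrix.mul_apply, Module.Basis.toMatrix_apply, inner_eq_coord hε.1]
    rw [gram, this, Matrix.det_mul, Matrix.det_transpose, Module.Basis.det_apply, sq]
  rw [H.eq_tripleDet hβ hq hε, hgram, Real.sqrt_sq hpos.le, tripleDet_eq_det, tripleDet_eq_det]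
  exact congrArg (fun φ => φ ![q, v, w]) (ε.det.eq_smul_basis_det e)

end OrthonormalBases

/-! ### Consequences of the monopole equation. -/

section Monopole

variable {W : Type*} [NormedAddCommGroup W] [NormedSpace ℝ W]
variable {h : W → W →L[ℝ] W →L[ℝ] ℝ} {u : W → ℝ} {A : W → W →L[ℝ] ℝ} {y₀ : W} {p : W × ℝ}

/-- Jacobi's formula at the identity matrix: the derivative of the determinant is the trace, and the
square root contributes ½. -/
theorem hasDerivAt_gram (H : IsLocalData h u A y₀) {e : Module.Basis (Fin 3) ℝ W}
    (he : ∀ i j, h y₀ (e i) (e j) = if i = j then 1 else 0) (x : W) :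
    HasDerivAt (fun s : ℝ => Real.sqrt (gram (h (y₀ + s • x)) e))
      (1 / 2 * ∑ i, fderiv ℝ h y₀ x (e i) (e i)) 0 := by
  have d := fun i j => hasDerivAt_line_apply_apply H.diff_h x (e i) (e j)
  have g : HasDerivAt (fun s : ℝ => gram (h (y₀ + s • x)) e)
      (∑ i, fderiv ℝ h y₀ x (e i) (e i)) 0 := by
    have := (((((((d 0 0).mul (d 1 1)).mul (d 2 2)).sub (((d 0 0).mul (d 1 2)).mul (d 2 1))).sub
      (((d 0 1).mul (d 1 0)).mul (d 2 2))).add (((d 0 1).mul (d 1 2)).mul (d 2 0))).add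
      (((d 0 2).mul (d 1 0)).mul (d 2 1))).sub (((d 0 2).mul (d 1 1)).mul (d 2 0))
    refine (this.congr_of_eventuallyEq
      (Filter.Eventually.of_forall fun s => Matrix.det_fin_three _)).congr_deriv ?_
    simp [he, Fin.sum_univ_three]
  have hne : gram (h (y₀ + (0 : ℝ) • x)) e ≠ 0 := by
    simp [gram, Matrix.det_fin_three, he]
  have h1 : gram (h (y₀ + (0 : ℝ) • x)) e = 1 := by
    simp [gram, Matrix.det_fin_three, he]
  refine (g.sqrt hne).congr_deriv ?_
  rw [h1, Real.sqrt_one]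
  ring

theorem gram_eq_one {B : W →L[ℝ] W →L[ℝ] ℝ} {e : Module.Basis (Fin 3) ℝ W}
    (he : ∀ i j, B (e i) (e j) = if i = j then 1 else 0) : gram B e = 1 := by
  simp [gram, Matrix.det_fin_three, he]

/-- The derivation property of the determinant. -/
theorem tripleDet_derivation (e : Module.Basis (Fin 3) ℝ W) (L : W →L[ℝ] W) (a b c : W) :
    tripleDet e (L a) b c + tripleDet e a (L b) c + tripleDet e a b (L c) =
      (∑ i, e.coord i (L (e i))) * tripleDet e a b c := by
  have hl : ∀ x i, e.coord i (L x) = e.coord 0 x * e.coord i (L (e 0)) +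
      e.coord 1 x * e.coord i (L (e 1)) + e.coord 2 x * e.coord i (L (e 2)) := by
    intro x i
    conv_lhs => rw [← e.sum_repr x, Fin.sum_univ_three]
    simp only [map_smul, smul_eq_mul, map_add, Module.Basis.coord_apply]
  simp only [tripleDet, Fin.sum_univ_three, hl a, hl b, hl c]
  ring

theorem curl_skew (A : W → W →L[ℝ] ℝ) (y v w : W) : curl A y v w = -curl A y w v := by
  rw [curl_apply, curl_apply]; ring

/-- The monopole equation in a chart, near a point. -/
def IsMonopoleNear (h : W → W →L[ℝ] W →L[ℝ] ℝ) (u : W → ℝ) (A : W → W →L[ℝ] ℝ)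
    (o : Orientation ℝ W (Fin 3)) (y₀ : W) : Prop :=
  ∀ᶠ z in 𝓝 y₀, IsHodgeStar (h z) o (fderiv ℝ u z) (fun v w => curl A z v w)

/-- This is d(dA) = 0, from the symmetry of the second derivative of A. -/
theorem curl_closed (H : IsLocalData h u A y₀) (x v w : W) :
    fderiv ℝ (curl A) y₀ x v w + fderiv ℝ (curl A) y₀ v w x + fderiv ℝ (curl A) y₀ w x v = 0 := by
  have h1 : ContDiffAt ℝ ∞ (fderiv ℝ A) y₀ := H.smooth_A.self_of_nhds.fderiv_right (by simp)
  have hd := h1.differentiableAt (by simp)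
  have hsym : ∀ x v, fderiv ℝ (fderiv ℝ A) y₀ x v = fderiv ℝ (fderiv ℝ A) y₀ v x :=
    H.smooth_A.self_of_nhds.isSymmSndFDerivAt (by
        simpa using (WithTop.coe_le_coe.2 le_top : ((2 : ℕ∞) : ℕ∞ω) ≤ ∞))
  have key : ∀ x v w, fderiv ℝ (curl A) y₀ x v w =
      fderiv ℝ (fderiv ℝ A) y₀ x v w - fderiv ℝ (fderiv ℝ A) y₀ x w v := fun x v w =>
    (hasDerivAt_line_apply_apply ((contDiffAt_curl H).differentiableAt (by simp)) x v w).unique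
      ((hasDerivAt_line_apply_apply hd x v w).sub (hasDerivAt_line_apply_apply hd x w v))
  simp only [key]
  rw [hsym x v, hsym v w, hsym w x]
  ring

variable [FiniteDimensional ℝ W]

/-- Covariant differentiation of dA = ι_q vol with ∇vol = 0. The parallelism of vol is checked by
hand: the derivative of the volume density is the trace of Γ(x, ·), which by `tripleDet_derivation`
is exactly what the Christoffel terms in the three slots produce. -/
theorem inner_covCurl_eq (H : IsLocalData h u A y₀) {o : Orientation ℝ W (Fin 3)}
    (mono : IsMonopoleNear h u A o y₀)
    {e : Module.Basis (Fin 3) ℝ W} (he : IsPosOrthonormal (h y₀) o e) (x v w : W) :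
    h y₀ (covCurl h A y₀ x v) w = tripleDet e (hess h u y₀ x) v w := by
  have hB := H.inner.self_of_nhds
  -- The basis `e` is kept fixed while z moves. It stays positively oriented but is orthonormal only
  -- at y₀, hence the Gram factor.
  have hev : ∀ᶠ z in 𝓝 y₀, curl A z v w = Real.sqrt (gram (h z) e) * tripleDet e (grad h u z) v w := by
    filter_upwards [mono, H.inner] with z hz hi
    exact hz.eq_sqrt_gram_mul hi (curl_skew A z) (inner_grad hi) he.2 v w
  have h0 : ∀ v w, curl A y₀ v w = tripleDet e (grad h u y₀) v w := fun v w =>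
    mono.self_of_nhds.eq_tripleDet (curl_skew A y₀) (inner_grad hB) he v w
  have d1 := hasDerivAt_line_apply_apply ((contDiffAt_curl H).differentiableAt (by simp)) x v w
  have dq := hasDerivAt_line ((contDiffAt_grad H).differentiableAt (by simp)) x
  have dc := fun i => (e.coord i).toContinuousLinearMap.hasFDerivAt.comp_hasDerivAt 0 dq
  have d2 := (hasDerivAt_gram H he.1 x).mul
    ((((dc 0).mul_const (e.coord 1 v * e.coord 2 w - e.coord 2 v * e.coord 1 w)).sub
      ((dc 1).mul_const (e.coord 0 v * e.coord 2 w - e.coord 2 v * e.coord 0 w))).add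
      ((dc 2).mul_const (e.coord 0 v * e.coord 1 w - e.coord 1 v * e.coord 0 w)))
  have eq := d1.unique (d2.congr_of_eventuallyEq (eventually_line hev x))
  have key : fderiv ℝ (curl A) y₀ x v w = (1 / 2 * ∑ i, fderiv ℝ h y₀ x (e i) (e i)) *
      tripleDet e (grad h u y₀) v w + tripleDet e (fderiv ℝ (grad h u) y₀ x) v w := by
    rw [eq]
    simp only [zero_smul, add_zero, gram_eq_one he.1, Real.sqrt_one, one_mul]
    simp only [tripleDet, Pi.add_apply, Pi.sub_apply, Function.comp_apply, zero_smul, add_zero]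
    rfl
  have htr : 1 / 2 * ∑ i, fderiv ℝ h y₀ x (e i) (e i) =
      ∑ i, e.coord i (christoffel h y₀ x (e i)) := by
    simp only [fderiv_eq_christoffel H.diff_h H.inner, coord_eq_inner he.1, Fin.sum_univ_three]
    simp only [hB.symm (e _)]
    ring
  rw [htr, fderiv_curl_eq_covCurl H, inner_curlOp hB, inner_curlOp hB, h0, h0,
    ← tripleDet_derivation e (christoffel h y₀ x)] at key
  have hsplit : tripleDet e (hess h u y₀ x) v w = tripleDet e (fderiv ℝ (grad h u) y₀ x) v w +
      tripleDet e (christoffel h y₀ x (grad h u y₀)) v w := by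
    simp only [hess, tripleDet, map_add]; ring
  rw [hsplit]
  linarith

/-- The Ricci curvature of a Gibbons–Hawking metric is that of the base. -/
theorem coordRicci_coordMetric_of_monopole (H : IsLocalData h u A p.1)
    {o : Orientation ℝ W (Fin 3)} (hW : Module.finrank ℝ W = 3)
    (mono : IsMonopoleNear h u A o p.1) (v w : W × ℝ) :
    coordRicci (coordMetric h u A) p v w = coordRicci h p.1 v.1 w.1 := by
  have hB := H.inner.self_of_nhds
  obtain ⟨e, he⟩ := hB.exists_isPosOrthonormal hW o
  have hk := inner_covCurl_eq H mono he
  have h0 : ∀ v w, curl A p.1 v w = tripleDet e (grad h u p.1) v w := fun v w =>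
    mono.self_of_nhds.eq_tripleDet (curl_skew A p.1) (inner_grad hB) he v w
  refine coordRicci_coordMetric H e he.1 (fun v i => ?_) (fun x v i => ?_) ?_ v w
  · rw [coord_eq_inner he.1, inner_curlOp hB, h0, tripleDet_basis]
  · rw [coord_eq_inner he.1, hk, tripleDet_basis]
  -- In the cyclic sum the Christoffel terms cancel by symmetry of Γ, and the sum of vol(∇_{e i} q,
  -- e j, e k) that is left is the trace of the Hessian.
  · have hc := curl_closed H (e 0) (e 1) (e 2)
    rw [fderiv_curl_eq_covCurl H, fderiv_curl_eq_covCurl H, fderiv_curl_eq_covCurl H, hk, hk, hk] at hc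
    simp only [inner_curlOp hB] at hc
    have hs := christoffel_symm H.diff_h H.inner
    rw [hs (e 1) (e 0), hs (e 2) (e 0), hs (e 2) (e 1),
      curl_skew A _ (christoffel h p.1 (e 0) (e 1)), curl_skew A _ (christoffel h p.1 (e 1) (e 2)),
      curl_skew A _ (christoffel h p.1 (e 0) (e 2))] at hc
    have t : tripleDet e (hess h u p.1 (e 0)) (e 1) (e 2) +
        tripleDet e (hess h u p.1 (e 1)) (e 2) (e 0) +
        tripleDet e (hess h u p.1 (e 2)) (e 0) (e 1) = 0 := by linarith
    rw [← t]
    simp [tripleDet, Fin.sum_univ_three]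

end Monopole


/-! ### Dependence on germs only. -/

section Germs

variable {W : Type*} [NormedAddCommGroup W] [NormedSpace ℝ W]

theorem christoffel_congr {G G' : W → W →L[ℝ] W →L[ℝ] ℝ} {y : W} (h : G =ᶠ[𝓝 y] G') :
    christoffel G =ᶠ[𝓝 y] christoffel G' := by
  filter_upwards [h, h.fderiv (𝕜 := ℝ)] with z h1 h2
  rw [christoffel, christoffel, christoffelLower, christoffelLower, derivPerm, derivPerm, h1, h2]

theorem coordRicci_congr {G G' : W → W →L[ℝ] W →L[ℝ] ℝ} {y : W} (h : G =ᶠ[𝓝 y] G') (v w : W) :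
    coordRicci G y v w = coordRicci G' y v w := by
  have h1 := christoffel_congr h
  rw [coordRicci, coordRicci, curvatureMap, curvatureMap, h1.fderiv_eq, h1.eq_of_nhds]

theorem coordLieDeriv_congr {G G' : W → W →L[ℝ] W →L[ℝ] ℝ} {X X' : W → W} {y : W}
    (h : G =ᶠ[𝓝 y] G') (hX : X =ᶠ[𝓝 y] X') (v w : W) :
    coordLieDeriv G X y v w = coordLieDeriv G' X' y v w := by
  rw [coordLieDeriv, coordLieDeriv, h.fderiv_eq, hX.fderiv_eq, h.eq_of_nhds, hX.eq_of_nhds]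

end Germs

/-! ### The Lie derivative of the metric along the flow field. -/

section LieDerivative

variable {W : Type*} [NormedAddCommGroup W] [NormedSpace ℝ W]
variable {h : W → W →L[ℝ] W →L[ℝ] ℝ} {u : W → ℝ} {A : W → W →L[ℝ] ℝ} {y₀ : W} {p : W × ℝ}
  {f : W × ℝ → ℝ} {F : W → W}

/-- The vector field `f ∂/∂t + t F̃` on `W × ℝ`. -/
def coordFlow (A : W → W →L[ℝ] ℝ) (f : W × ℝ → ℝ) (F : W → W) (p : W × ℝ) : W × ℝ :=
  (p.2 • F p.1, f p - p.2 * A p.1 (F p.1))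

theorem hasDerivAt_coordFlow (hA : DifferentiableAt ℝ A p.1) (hf : DifferentiableAt ℝ f p)
    (hF : DifferentiableAt ℝ F p.1) (v : W × ℝ) :
    HasDerivAt (fun s : ℝ => coordFlow A f F (p + s • v))
      (p.2 • fderiv ℝ F p.1 v.1 + v.2 • F p.1,
        fderiv ℝ f p v - (v.2 * A p.1 (F p.1) +
          p.2 * (fderiv ℝ A p.1 v.1 (F p.1) + A p.1 (fderiv ℝ F p.1 v.1)))) 0 := by
  have dF := hasDerivAt_line hF v.1
  have dA := (hasDerivAt_line hA v.1).clm_apply dF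
  have df := hasDerivAt_line hf v
  have dt : HasDerivAt (fun s : ℝ => p.2 + s * v.2) v.2 0 := by
    simpa using ((hasDerivAt_id (0 : ℝ)).mul_const v.2).const_add p.2
  have := (dt.smul dF).prodMk (df.sub (dt.mul dA))
  refine this.congr_deriv ?_
  simp

theorem differentiableAt_coordFlow (hA : DifferentiableAt ℝ A p.1) (hf : DifferentiableAt ℝ f p)
    (hF : DifferentiableAt ℝ F p.1) : DifferentiableAt ℝ (coordFlow A f F) p := by
  have h1 : DifferentiableAt ℝ (fun p : W × ℝ => F p.1) p := hF.comp p differentiableAt_fst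
  have h2 : DifferentiableAt ℝ (fun p : W × ℝ => A p.1) p := hA.comp p differentiableAt_fst
  exact (differentiableAt_snd.smul h1).prodMk (hf.sub (differentiableAt_snd.mul (h2.clm_apply h1)))

/-- Since θ(E) = f and dθ = dA, Cartan's formula gives L_E θ = df + t ι_F dA. On the base part,
L_{tF} h = t L_F h + dt ⊗ F♭ + F♭ ⊗ dt, which is the source of the last line. The code verifies this
by expanding coordinates. -/
theorem coordLieDeriv_coordMetric (H : IsLocalData h u A p.1) (hf : DifferentiableAt ℝ f p)
    (hF : DifferentiableAt ℝ F p.1) (v w : W × ℝ) :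
    coordLieDeriv (coordMetric h u A) (coordFlow A f F) p v w =
      p.2 * (fderiv ℝ u p.1 (F p.1) * h p.1 v.1 w.1 + u p.1 * coordLieDeriv h F p.1 v.1 w.1) -
        p.2 * (u p.1)⁻¹ ^ 2 * fderiv ℝ u p.1 (F p.1) * (connForm A p v * connForm A p w) +
        (u p.1)⁻¹ * ((fderiv ℝ f p v + p.2 * curl A p.1 (F p.1) v.1) * connForm A p w +
          (fderiv ℝ f p w + p.2 * curl A p.1 (F p.1) w.1) * connForm A p v) +
        u p.1 * (v.2 * h p.1 (F p.1) w.1 + w.2 * h p.1 (F p.1) v.1) := by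
  have hX : ∀ v, fderiv ℝ (coordFlow A f F) p v = _ := fun v =>
    (hasDerivAt_line (differentiableAt_coordFlow H.diff_A hf hF) v).unique
      (hasDerivAt_coordFlow H.diff_A hf hF v)
  rw [coordLieDeriv, fderiv_coordMetric H, hX, hX, coordMetric_apply, coordMetric_apply,
    coordLieDeriv, curl_apply, curl_apply, H.inner.self_of_nhds.symm (F p.1) v.1]
  simp only [connForm_apply, coordFlow, map_add, map_smul, add_apply, smul_apply, smul_eq_mul]
  ring

end LieDerivative


/-! ### Tensors, forms and fields read in a chart. -/

section ChartFrame

variable {W : Type*} [NormedAddCommGroup W] [NormedSpace ℝ W]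
  {H : Type*} [TopologicalSpace H] {I : ModelWithCorners ℝ W H}
  {M : Type*} [TopologicalSpace M] [ChartedSpace H M]

theorem symm_chart_mem_source (x : M) {y : W} (hy : y ∈ (extChartAt I x).target) :
    (extChartAt I x).symm y ∈ (chartAt H x).source := by
  rw [← extChartAt_source I]; exact (extChartAt I x).map_target hy

theorem contDiffAt_of_contMDiffAt_trivial {E F : Type*} [NormedAddCommGroup E] [NormedSpace ℝ E]
    [NormedAddCommGroup F] [NormedSpace ℝ F] {b : E → M} {f : E → F} {y : E}
    (h : ContMDiffAt 𝓘(ℝ, E) (I.prod 𝓘(ℝ, F)) ∞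
      (fun z => Bundle.TotalSpace.mk' F (E := Bundle.Trivial M F) (b z) (f z)) y) :
    ContDiffAt ℝ ∞ f y := by
  rw [Bundle.contMDiffAt_totalSpace] at h
  exact h.2.contDiffAt

theorem fieldInChart_apply (X : ∀ x : M, TangentSpace I x) (x : M) (y : W) :
    fieldInChart I X x y = (chartFrame I x y).inverse (X ((extChartAt I x).symm y)) := rfl

/-- All tangent spaces are definitionally W, so values at equal base points can be compared as forms
on W without dependent rewriting. -/
theorem tensor_congr (g : ∀ x : M, TangentSpace I x →L[ℝ] TangentSpace I x →L[ℝ] ℝ) {x z : M}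
    (h : z = x) (v w : W) : (g z : W →L[ℝ] W →L[ℝ] ℝ) v w = (g x : W →L[ℝ] W →L[ℝ] ℝ) v w := by
  subst h; rfl

theorem form_congr (A : ∀ x : M, TangentSpace I x →L[ℝ] ℝ) {x z : M}
    (h : z = x) (v : W) : (A z : W →L[ℝ] ℝ) v = (A x : W →L[ℝ] ℝ) v := by
  subst h; rfl

theorem field_congr (X : ∀ x : M, TangentSpace I x) {x z : M} (h : z = x) :
    (X z : W) = (X x : W) := by
  subst h; rfl

variable [I.Boundaryless] [IsManifold I ∞ M]

theorem contMDiffAt_symm_chart (x : M) {y : W} (hy : y ∈ (extChartAt I x).target) :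
    ContMDiffAt 𝓘(ℝ, W) I ∞ (extChartAt I x).symm y :=
  (contMDiffOn_extChartAt_symm x).contMDiffAt ((isOpen_extChartAt_target x).mem_nhds hy)

theorem isInvertible_chartFrame (x : M) {y : W} (hy : y ∈ (extChartAt I x).target) :
    (chartFrame I x y).IsInvertible := by
  have := isInvertible_mfderivWithin_extChartAt_symm (I := I) hy
  rwa [I.range_eq_univ, mfderivWithin_univ] at this

theorem chartFrame_eq_symmL (x : M) {y : W} (hy : y ∈ (extChartAt I x).target) :
    chartFrame I x y = (trivializationAt W (TangentSpace I : M → Type _) x).symmL ℝ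
      ((extChartAt I x).symm y) := by
  rw [TangentBundle.symmL_trivializationAt (symm_chart_mem_source x hy), I.range_eq_univ,
    mfderivWithin_univ, (extChartAt I x).right_inv hy]
  rfl

/-- The tangent space at x is identified with W by the chart at x, so the frame is the identity at
the centre. Chart expressions there agree with the tensors themselves. -/
theorem chartFrame_self_apply (x : M) (v : W) :
    (chartFrame I x (extChartAt I x x) v : W) = v := by
  have h1 := chartFrame_eq_symmL (I := I) x (mem_extChartAt_target x)
  have hx : (extChartAt I x).symm (extChartAt I x x) = x := extChartAt_to_inv x
  have h2 : ∀ z : M, z = x → ((trivializationAt W (TangentSpace I : M → Type _) x).symmL ℝ z v : W)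
      = v := by
    rintro z rfl
    rw [TangentBundle.symmL_trivializationAt_eq_core (mem_chart_source H z)]
    exact (tangentBundleCore I M).coordChange_self _ _ (mem_chart_source H z) v
  rw [h1]
  exact h2 _ hx

/-- The coordinate frame is the inverse of the bundle trivialization at x, which is smooth. -/
theorem contMDiffAt_chartFrame (x : M) {y : W} (hy : y ∈ (extChartAt I x).target) (v : W) :
    ContMDiffAt 𝓘(ℝ, W) I.tangent ∞
      (fun z => (⟨(extChartAt I x).symm z, chartFrame I x z v⟩ : TangentBundle I M)) y := by
  let e := trivializationAt W (TangentSpace I : M → Type _) x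
  have h1 : ContMDiffAt 𝓘(ℝ, W) (I.prod 𝓘(ℝ, W)) ∞
      (fun z => ((extChartAt I x).symm z, v)) y :=
    (contMDiffAt_symm_chart x hy).prodMk contMDiffAt_const
  have hmem : ∀ z ∈ (extChartAt I x).target, (extChartAt I x).symm z ∈ e.baseSet := fun z hz =>
    symm_chart_mem_source x hz
  have h2 : ContMDiffAt (I.prod 𝓘(ℝ, W)) I.tangent ∞ e.toOpenPartialHomeomorph.symm
      ((extChartAt I x).symm y, v) :=
    (e.contMDiffOn_symm (IB := I) (n := ∞)).contMDiffAt
      (e.open_target.mem_nhds (e.mem_target.2 (hmem y hy)))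
  refine (h2.comp y h1).congr_of_eventuallyEq ?_
  filter_upwards [(isOpen_extChartAt_target x).mem_nhds hy] with z hz
  rw [chartFrame_eq_symmL x hz, Function.comp_apply,
    e.symm_apply_eq_mk_continuousLinearEquivAt_symm (R := ℝ) _ (hmem z hz)]
  congr 1
  exact (congrFun (e.symm_continuousLinearEquivAt_eq (R := ℝ) (hmem z hz)) v).symm

theorem contDiffOn_tensorInChart [FiniteDimensional ℝ W]
    {g : ∀ x : M, TangentSpace I x →L[ℝ] TangentSpace I x →L[ℝ] ℝ}
    (hg : ContMDiff I (I.prod 𝓘(ℝ, W →L[ℝ] W →L[ℝ] ℝ)) ∞ (fun x =>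
      Bundle.TotalSpace.mk' (W →L[ℝ] W →L[ℝ] ℝ)
        (E := fun x : M => TangentSpace I x →L[ℝ] TangentSpace I x →L[ℝ] ℝ) x (g x))) (x : M) :
    ContDiffOn ℝ ∞ (tensorInChart I g x) (extChartAt I x).target := by
  rw [contDiffOn_clm_apply]
  intro v
  rw [contDiffOn_clm_apply]
  intro w y hy
  refine (contDiffAt_of_contMDiffAt_trivial (M := M) (I := I) (b := (extChartAt I x).symm)
    ?_).contDiffWithinAt
  exact ContMDiffAt.clm_bundle_apply₂ (F₁ := W) (F₂ := W) (F₃ := ℝ)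
    (E₃ := Bundle.Trivial M ℝ)
    ((hg _).comp y (contMDiffAt_symm_chart x hy)) (contMDiffAt_chartFrame x hy v)
    (contMDiffAt_chartFrame x hy w)

theorem contDiffOn_formInChart [FiniteDimensional ℝ W]
    {A : ∀ x : M, TangentSpace I x →L[ℝ] ℝ} [IsManifold I 1 M] (hA : IsFormOfClass I ∞ A) (x : M) :
    ContDiffOn ℝ ∞ (formInChart I A x) (extChartAt I x).target := by
  rw [contDiffOn_clm_apply]
  intro v y hy
  refine (contDiffAt_of_contMDiffAt_trivial (M := M) (I := I) (b := (extChartAt I x).symm)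
    ?_).contDiffWithinAt
  exact ContMDiffAt.clm_bundle_apply (F₁ := W) (F₂ := ℝ)
    (E₂ := Bundle.Trivial M ℝ)
    ((hA _).comp y (contMDiffAt_symm_chart x hy)) (contMDiffAt_chartFrame x hy v)

theorem contDiffAt_comp_symm_chart {u : M → ℝ} (hu : ContMDiff I 𝓘(ℝ, ℝ) ∞ u) (x : M) {y : W}
    (hy : y ∈ (extChartAt I x).target) : ContDiffAt ℝ ∞ (fun y => u ((extChartAt I x).symm y)) y :=
  ((hu _).comp y (contMDiffAt_symm_chart x hy)).contDiffAt

theorem contDiffAt_fieldInChart [CompleteSpace W] {X : ∀ x : M, TangentSpace I x} [IsManifold I 1 M]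
    (hX : IsFieldOfClass I ∞ X) (x : M) {y : W} (hy : y ∈ (extChartAt I x).target) :
    ContDiffAt ℝ ∞ (fieldInChart I X x) y := by
  have hi := isInvertible_chartFrame (I := I) x hy
  have := ContMDiffAt.mpullback_vectorField_preimage (hX _) (contMDiffAt_symm_chart x hy)
    hi (by simp)
  exact contMDiffAt_vectorSpace_iff_contDiffAt.1 this

theorem chartFrame_fieldInChart (X : ∀ x : M, TangentSpace I x) (x : M) {y : W}
    (hy : y ∈ (extChartAt I x).target) :
    chartFrame I x y (fieldInChart I X x y) = X ((extChartAt I x).symm y) :=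
  (isInvertible_chartFrame x hy).self_apply_inverse _

theorem tensorInChart_self (g : ∀ x : M, TangentSpace I x →L[ℝ] TangentSpace I x →L[ℝ] ℝ)
    (x : M) (v w : W) : tensorInChart I g x (extChartAt I x x) v w = g x v w := by
  rw [tensorInChart_apply]
  refine (tensor_congr g (extChartAt_to_inv x) _ _).trans ?_
  exact congrArg₂ (fun v w : W => (g x : W →L[ℝ] W →L[ℝ] ℝ) v w) (chartFrame_self_apply x v)
    (chartFrame_self_apply x w)

theorem formInChart_self (A : ∀ x : M, TangentSpace I x →L[ℝ] ℝ)
    (x : M) (v : W) : formInChart I A x (extChartAt I x x) v = A x v :=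
  (form_congr A (extChartAt_to_inv x) _).trans
    (congrArg (fun v : W => (A x : W →L[ℝ] ℝ) v) (chartFrame_self_apply x v))

theorem fieldInChart_self (X : ∀ x : M, TangentSpace I x) (x : M) :
    fieldInChart I X x (extChartAt I x x) = X x := by
  have h1 := chartFrame_fieldInChart (I := I) X x (mem_extChartAt_target x)
  exact (chartFrame_self_apply x _).symm.trans ((congrArg (fun v : W => v) h1).trans
    (field_congr X (extChartAt_to_inv x)))

theorem isInnerForm_tensorInChart
    {g : ∀ x : M, TangentSpace I x →L[ℝ] TangentSpace I x →L[ℝ] ℝ}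
    (hs : ∀ x v w, g x v w = g x w v) (hp : ∀ x v, v ≠ 0 → 0 < g x v v) (x : M) {y : W}
    (hy : y ∈ (extChartAt I x).target) : IsInnerForm (tensorInChart I g x y) where
  symm v w := hs _ _ _
  pos v hv := hp _ _ fun h0 => hv <| by
    have := (isInvertible_chartFrame x hy).inverse_apply_self v
    exact this.symm.trans ((congrArg (chartFrame I x y).inverse h0).trans (map_zero _))

theorem mvfderiv_chartFrame {u : M → ℝ} (hu : ContMDiff I 𝓘(ℝ, ℝ) ∞ u) (x : M) {y : W}
    (hy : y ∈ (extChartAt I x).target) (v : W) :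
    mvfderiv I u ((extChartAt I x).symm y) (chartFrame I x y v) =
      fderiv ℝ (fun y => u ((extChartAt I x).symm y)) y v := by
  have h1 : MDifferentiableAt I 𝓘(ℝ, ℝ) u ((extChartAt I x).symm y) :=
    (hu _).mdifferentiableAt (by simp)
  have h2 := (contMDiffAt_symm_chart x hy).mdifferentiableAt (by simp)
  have := mfderiv_comp_apply y h1 h2 v
  rw [mfderiv_eq_fderiv] at this
  exact this.symm

theorem mvfderiv_eq_fderiv_chart {u : M → ℝ} (hu : ContMDiff I 𝓘(ℝ, ℝ) ∞ u) (x : M) (v : W) :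
    mvfderiv I u x v = fderiv ℝ (fun y => u ((extChartAt I x).symm y)) (extChartAt I x x) v := by
  rw [← mvfderiv_chartFrame hu x (mem_extChartAt_target x)]
  exact ((form_congr (mvfderiv I u) (extChartAt_to_inv x) _).trans
    (congrArg (fun v : W => (mvfderiv I u x : W →L[ℝ] ℝ) v) (chartFrame_self_apply x v))).symm

end ChartFrame


/-! ### Independence of the chart, and the monopole equation near a point. -/

section Naturality

variable {W : Type*} [NormedAddCommGroup W] [NormedSpace ℝ W]
  {H : Type*} [TopologicalSpace H] {I : ModelWithCorners ℝ W H}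
  {M : Type*} [TopologicalSpace M] [ChartedSpace H M]

/-- Naturality of d: the term containing the second derivative of ψ is symmetric and disappears from
the difference. -/
theorem curl_pullback {A A' : W → W →L[ℝ] ℝ} {ψ : W → W} {y : W} (hψ : ContDiffAt ℝ ∞ ψ y)
    (hA : DifferentiableAt ℝ A (ψ y)) (hA' : DifferentiableAt ℝ A' y)
    (h : ∀ᶠ z in 𝓝 y, ∀ v, A' z v = A (ψ z) (fderiv ℝ ψ z v)) (v w : W) :
    curl A' y v w = curl A (ψ y) (fderiv ℝ ψ y v) (fderiv ℝ ψ y w) := by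
  have h1 : DifferentiableAt ℝ (fderiv ℝ ψ) y :=
    (hψ.fderiv_right (m := ∞) (by simp)).differentiableAt (by simp)
  have hψd := hψ.differentiableAt (by simp : (∞ : ℕ∞ω) ≠ 0)
  have key : ∀ v w, fderiv ℝ A' y v w = fderiv ℝ A (ψ y) (fderiv ℝ ψ y v) (fderiv ℝ ψ y w) +
      A (ψ y) (fderiv ℝ (fderiv ℝ ψ) y v w) := by
    intro v w
    have d1 := hasDerivAt_line_apply hA' v w
    have hc : DifferentiableAt ℝ (fun z => A (ψ z)) y := hA.comp y hψd
    have d2 := (hasDerivAt_line hc v).clm_apply (hasDerivAt_line_apply h1 v w)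
    have := d1.unique (d2.congr_of_eventuallyEq (eventually_line (h.mono fun z hz => hz w) v))
    rw [this]
    have e : fderiv ℝ (fun z => A (ψ z)) y = (fderiv ℝ A (ψ y)).comp (fderiv ℝ ψ y) :=
      fderiv_comp y hA hψd
    simp only [e, zero_smul, add_zero]
    rfl
  have hsym : fderiv ℝ (fderiv ℝ ψ) y v w = fderiv ℝ (fderiv ℝ ψ) y w v :=
    hψ.isSymmSndFDerivAt (by
      simpa using (WithTop.coe_le_coe.2 le_top : ((2 : ℕ∞) : ℕ∞ω) ≤ ∞)) v w
  rw [curl_apply, curl_apply, key, key, hsym]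
  ring

variable [I.Boundaryless] [IsManifold I ∞ M]

theorem contDiffAt_formInChart [FiniteDimensional ℝ W]
    {A : ∀ x : M, TangentSpace I x →L[ℝ] ℝ} [IsManifold I 1 M] (hA : IsFormOfClass I ∞ A) (x : M)
    {y : W} (hy : y ∈ (extChartAt I x).target) : ContDiffAt ℝ ∞ (formInChart I A x) y :=
  (contDiffOn_formInChart hA x).contDiffAt ((isOpen_extChartAt_target x).mem_nhds hy)

/-- The exterior derivative may be computed in any chart. -/
theorem extDerivOne_chartFrame [FiniteDimensional ℝ W]
    {A : ∀ x : M, TangentSpace I x →L[ℝ] ℝ} [IsManifold I 1 M] (hA : IsFormOfClass I ∞ A) (x : M)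
    {y : W} (hy : y ∈ (extChartAt I x).target) (v w : W) :
    extDerivOne I A ((extChartAt I x).symm y) (chartFrame I x y v) (chartFrame I x y w) =
      curl (formInChart I A x) y v w := by
  set z := (extChartAt I x).symm y with hz
  -- The transition map from the chart at x to the chart at z, in which `extDerivOne` at z is
  -- defined. The frame of the latter is the identity at its centre, so the frame of the chart at x
  -- at y is the derivative of ψ.
  let ψ : W → W := fun y' => extChartAt I z ((extChartAt I x).symm y')
  have hsrc : ∀ᶠ y' in 𝓝 y, (extChartAt I x).symm y' ∈ (extChartAt I z).source :=
    (contMDiffAt_symm_chart x hy).continuousAt.eventually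
      ((isOpen_extChartAt_source z).mem_nhds (mem_extChartAt_source z))
  have htar : ∀ᶠ y' in 𝓝 y, y' ∈ (extChartAt I x).target :=
    (isOpen_extChartAt_target x).mem_nhds hy
  have hψ : ∀ y' ∈ (extChartAt I x).target, (extChartAt I x).symm y' ∈ (extChartAt I z).source →
      ContDiffAt ℝ ∞ ψ y' := by
    intro y' h1 h2
    rw [extChartAt_source] at h2
    exact ((contMDiffAt_extChartAt' h2).comp y' (contMDiffAt_symm_chart x h1)).contDiffAt
  have hcf : ∀ᶠ y' in 𝓝 y, ∀ v : W, (chartFrame I x y' v : W) =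
      chartFrame I z (ψ y') (fderiv ℝ ψ y' v) := by
    filter_upwards [hsrc, htar, hsrc.eventually_nhds] with y' h1 h2 h3 v
    have heq : (extChartAt I x).symm =ᶠ[𝓝 y'] (extChartAt I z).symm ∘ ψ := by
      filter_upwards [h3] with y'' h4
      exact ((extChartAt I z).left_inv h4).symm
    have e1 := heq.mfderiv_eq (I := 𝓘(ℝ, W)) (I' := I)
    have hmem : ψ y' ∈ (extChartAt I z).target := (extChartAt I z).map_source h1
    have e2 := mfderiv_comp_apply (I := 𝓘(ℝ, W)) (I' := 𝓘(ℝ, W)) (I'' := I) y'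
      ((contMDiffAt_symm_chart z hmem).mdifferentiableAt (by simp))
      ((hψ y' h2 h1).contMDiffAt.mdifferentiableAt (by simp)) v
    rw [mfderiv_eq_fderiv] at e2
    exact (congrArg (fun L : W →L[ℝ] W => L v) e1).trans e2
  have hform : ∀ᶠ y' in 𝓝 y, ∀ v, formInChart I A x y' v =
      formInChart I A z (ψ y') (fderiv ℝ ψ y' v) := by
    filter_upwards [hcf, hsrc] with y' h1 h2 v
    exact (congrArg (fun v : W => (A ((extChartAt I x).symm y') : W →L[ℝ] ℝ) v) (h1 v)).trans
      (form_congr A ((extChartAt I z).left_inv h2).symm _)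
  have hψy : ψ y = extChartAt I z z := rfl
  have hfr : ∀ v : W, (chartFrame I x y v : W) = fderiv ℝ ψ y v := fun v =>
    (hcf.self_of_nhds v).trans (chartFrame_self_apply z _)
  rw [curl_pullback (hψ y hy (mem_extChartAt_source z))
    ((contDiffAt_formInChart hA z (mem_extChartAt_target z)).differentiableAt (by simp))
    ((contDiffAt_formInChart hA x hy).differentiableAt (by simp)) hform, ← hfr, ← hfr]
  rfl

/-- A positive orthonormal basis for the chart metric at y is carried by the chart frame to one on
the manifold, the orientation being constant in the trivialization. There the hypothesis applies,
and both du and dA pull back to the chart at x. -/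
theorem isMonopoleNear_of_isHodgeStar [FiniteDimensional ℝ W] [IsManifold I 1 M]
    {g : ∀ x : M, TangentSpace I x →L[ℝ] TangentSpace I x →L[ℝ] ℝ}
    {o : ∀ x : M, Orientation ℝ (TangentSpace I x) (Fin 3)} (ho : IsOrientation I o)
    {u : M → ℝ} (hu : ContMDiff I 𝓘(ℝ, ℝ) ∞ u)
    {A : ∀ x : M, TangentSpace I x →L[ℝ] ℝ} (hA : IsFormOfClass I ∞ A)
    (monopole : ∀ x, IsHodgeStar (g x) (o x) (mvfderiv I u x) (extDerivOne I A x)) (x : M) :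
    IsMonopoleNear (tensorInChart I g x) (fun y => u ((extChartAt I x).symm y))
      (formInChart I A x) (o x : Orientation ℝ W (Fin 3)) (extChartAt I x x) := by
  have h0 : Filter.Tendsto (extChartAt I x).symm (𝓝 (extChartAt I x x)) (𝓝 x) := by
    have := (contMDiffAt_symm_chart (I := I) x (mem_extChartAt_target x)).continuousAt.tendsto
    rwa [extChartAt_to_inv] at this
  filter_upwards [h0.eventually (ho x), (isOpen_extChartAt_target x).mem_nhds
    (mem_extChartAt_target x)] with y ⟨hb, hor⟩ hy e he i
  let L := ((trivializationAt W (TangentSpace I : M → Type _) x).continuousLinearEquivAt ℝ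
    ((extChartAt I x).symm y) hb).toLinearEquiv
  have hL : ∀ v, L.symm v = chartFrame I x y v := by
    intro v
    rw [chartFrame_eq_symmL x hy]
    exact congrFun (Bundle.Trivialization.symm_continuousLinearEquivAt_eq _ hb) v
  have := monopole ((extChartAt I x).symm y) (e.map L.symm) ⟨fun i j => ?_, ?_⟩ i
  · simp only [Module.Basis.map_apply, hL] at this
    rw [mvfderiv_chartFrame hu x hy, extDerivOne_chartFrame hA x hy] at this
    exact this
  · rw [Module.Basis.map_apply, Module.Basis.map_apply, hL, hL]
    exact he.1 i j
  · rw [Module.Basis.orientation_map, he.2, ← hor]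
    exact (Orientation.map (Fin 3) L).symm_apply_apply _

end Naturality

/-! ### Charts of N × ℝ and the given data in them. -/

section Product

variable {W : Type*} [NormedAddCommGroup W] [NormedSpace ℝ W]
  {H : Type*} [TopologicalSpace H] {I : ModelWithCorners ℝ W H}
  {N : Type*} [TopologicalSpace N] [ChartedSpace H N]

theorem theta_apply (A : ∀ x : N, TangentSpace I x →L[ℝ] ℝ) (x : N) (t : ℝ) (v : W × ℝ) :
    theta I A (x, t) v = v.2 + A x v.1 := by
  rw [theta, mvfderiv, mfderiv_snd, mfderiv_fst]
  rfl

theorem metric_apply_eq (h : ∀ x : N, TangentSpace I x →L[ℝ] TangentSpace I x →L[ℝ] ℝ) (u : N → ℝ)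
    (A : ∀ x : N, TangentSpace I x →L[ℝ] ℝ) (x : N) (t : ℝ) (v w : W × ℝ) :
    metric I h u A (x, t) v w =
      u x * h x v.1 w.1 + (u x)⁻¹ * ((v.2 + A x v.1) * (w.2 + A x w.1)) := by
  have hθ : (theta I A (x, t) : W × ℝ →L[ℝ] ℝ) =
      ContinuousLinearMap.snd ℝ W ℝ + (A x : W →L[ℝ] ℝ) ∘L ContinuousLinearMap.fst ℝ W ℝ :=
    ContinuousLinearMap.ext fun v => theta_apply A x t v
  have hf : (mfderiv (I.prod 𝓘(ℝ, ℝ)) I (Prod.fst : N × ℝ → N) (x, t) : W × ℝ →L[ℝ] W) =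
      ContinuousLinearMap.fst ℝ W ℝ := mfderiv_fst
  exact congrArg₂ (fun (L : W × ℝ →L[ℝ] W) (θ : W × ℝ →L[ℝ] ℝ) =>
    u x * (h x : W →L[ℝ] W →L[ℝ] ℝ) (L v) (L w) + (u x)⁻¹ * (θ v * θ w)) hf hθ

theorem extChartAt_prod_real (x : N) (t : ℝ) : extChartAt (I.prod 𝓘(ℝ, ℝ)) (x, t) =
    (extChartAt I x).prod (PartialEquiv.refl ℝ) := by
  rw [extChartAt_prod, extChartAt_model_space_eq_id]

theorem extChartAt_prod_real_self (x : N) (t : ℝ) :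
    extChartAt (I.prod 𝓘(ℝ, ℝ)) (x, t) (x, t) = (extChartAt I x x, t) := by
  rw [extChartAt_prod_real]; rfl

theorem extChartAt_prod_real_symm (x : N) (t : ℝ) :
    ((extChartAt (I.prod 𝓘(ℝ, ℝ)) (x, t)).symm : W × ℝ → N × ℝ) =
      Prod.map (extChartAt I x).symm id := by
  rw [extChartAt_prod_real]; rfl

theorem mem_target_prod (x : N) (t : ℝ) {p : W × ℝ} (hp : p.1 ∈ (extChartAt I x).target) :
    p ∈ (extChartAt (I.prod 𝓘(ℝ, ℝ)) ((x, t) : N × ℝ)).target := by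
  rw [extChartAt_prod_real]; exact ⟨hp, Set.mem_univ _⟩

variable [I.Boundaryless] [IsManifold I ∞ N]

theorem chartFrame_prod_apply (x : N) (t : ℝ) {p : W × ℝ} (hp : p.1 ∈ (extChartAt I x).target)
    (v : W × ℝ) :
    (chartFrame (I.prod 𝓘(ℝ, ℝ)) ((x, t) : N × ℝ) p v : W × ℝ) =
      ((chartFrame I x p.1 v.1 : W), v.2) := by
  have h1 := (contMDiffAt_symm_chart (I := I) x hp).mdifferentiableAt (by simp)
  have h2 : MDifferentiableAt 𝓘(ℝ, ℝ) 𝓘(ℝ, ℝ) (id : ℝ → ℝ) p.2 := mdifferentiableAt_id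
  have h3 := mfderiv_prodMap (p := p) h1 h2
  have h4 : (mfderiv 𝓘(ℝ, W × ℝ) (I.prod 𝓘(ℝ, ℝ))
      (extChartAt (I.prod 𝓘(ℝ, ℝ)) ((x, t) : N × ℝ)).symm p : W × ℝ →L[ℝ] W × ℝ) =
      mfderiv (𝓘(ℝ, W).prod 𝓘(ℝ, ℝ)) (I.prod 𝓘(ℝ, ℝ)) (Prod.map (extChartAt I x).symm id) p := by
    rw [extChartAt_prod_real_symm, modelWithCornersSelf_prod, ← chartedSpaceSelf_prod]
  rw [mfderiv_id] at h3
  exact congrArg (fun L : W × ℝ →L[ℝ] W × ℝ => L v) (h4.trans h3)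

theorem tensorInChart_metric (h : ∀ x : N, TangentSpace I x →L[ℝ] TangentSpace I x →L[ℝ] ℝ)
    (u : N → ℝ) (A : ∀ x : N, TangentSpace I x →L[ℝ] ℝ) (x : N) (t : ℝ) {p : W × ℝ}
    (hp : p.1 ∈ (extChartAt I x).target) :
    tensorInChart (I.prod 𝓘(ℝ, ℝ)) (metric I h u A) (x, t) p =
      coordMetric (tensorInChart I h x) (fun y => u ((extChartAt I x).symm y))
        (formInChart I A x) p := by
  refine ContinuousLinearMap.ext fun v => ContinuousLinearMap.ext fun w => ?_
  have h1 : (extChartAt (I.prod 𝓘(ℝ, ℝ)) ((x, t) : N × ℝ)).symm p =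
      ((extChartAt I x).symm p.1, p.2) := by rw [extChartAt_prod_real_symm]; rfl
  rw [tensorInChart_apply]
  refine (tensor_congr (metric I h u A) h1 _ _).trans ?_
  refine (congrArg₂ (fun v w : W × ℝ => (metric I h u A ((extChartAt I x).symm p.1, p.2) :
    W × ℝ →L[ℝ] W × ℝ →L[ℝ] ℝ) v w) (chartFrame_prod_apply x t hp v)
    (chartFrame_prod_apply x t hp w)).trans ?_
  exact metric_apply_eq h u A _ _ _ _

theorem fieldInChart_flowField (f : N × ℝ → ℝ) (A : ∀ x : N, TangentSpace I x →L[ℝ] ℝ)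
    (F : ∀ x : N, TangentSpace I x) (x : N) (t : ℝ) {p : W × ℝ}
    (hp : p.1 ∈ (extChartAt I x).target) :
    fieldInChart (I.prod 𝓘(ℝ, ℝ)) (flowField I A f F) (x, t) p =
      coordFlow (formInChart I A x) (fun p => f ((extChartAt I x).symm p.1, p.2))
        (fieldInChart I F x) p := by
  have hi := isInvertible_chartFrame (I := I.prod 𝓘(ℝ, ℝ)) (M := N × ℝ) (x, t)
    (mem_target_prod x t hp)
  have h1 : (extChartAt (I.prod 𝓘(ℝ, ℝ)) ((x, t) : N × ℝ)).symm p =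
      ((extChartAt I x).symm p.1, p.2) := by rw [extChartAt_prod_real_symm]; rfl
  rw [fieldInChart_apply]
  refine (hi.inverse_apply_eq).2 ?_
  refine (field_congr (flowField I A f F) h1).trans (Eq.trans ?_ (chartFrame_prod_apply x t hp _).symm)
  have hF := chartFrame_fieldInChart (I := I) F x hp
  have h2 : (chartFrame I x p.1 (p.2 • fieldInChart I F x p.1) : W) =
      p.2 • (F ((extChartAt I x).symm p.1) : W) :=
    ((chartFrame I x p.1).map_smul _ _).trans (congrArg (fun v : W => p.2 • v) hF)
  have h3 : formInChart I A x p.1 (fieldInChart I F x p.1) =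
      A ((extChartAt I x).symm p.1) (F ((extChartAt I x).symm p.1)) :=
    congrArg (A ((extChartAt I x).symm p.1)) hF
  refine Prod.ext ?_ ?_
  · refine Eq.trans ?_ h2.symm
    have h4 : ∀ (c d : ℝ) (v : W), c • (0 : W) + d • v = d • v := fun c d v => by simp
    exact h4 _ _ _
  · change f _ * 1 + p.2 * -(A ((extChartAt I x).symm p.1) (F ((extChartAt I x).symm p.1))) =
      f _ - p.2 * (formInChart I A x p.1 (fieldInChart I F x p.1))
    rw [h3]; ring

end Product


/-! ### The cross product relation rewritten through dA. -/

section Cross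

variable {W : Type*} [NormedAddCommGroup W] [NormedSpace ℝ W]

/-- If `α = *K`, then `γ = *(2 α ∧ F♭)` if and only if `γ = 2 K(F, ·)`. -/
theorem isCross_iff {B : W →L[ℝ] W →L[ℝ] ℝ} (hB : IsInnerForm B) (hW : Module.finrank ℝ W = 3)
    {o : Orientation ℝ W (Fin 3)} {α γ : W →L[ℝ] ℝ} {K : W →L[ℝ] W →L[ℝ] ℝ}
    (H : IsHodgeStar B o α (fun v w => K v w)) (hK : ∀ v w, K v w = -K w v) (F : W) :
    IsCross B o γ (fun v => 2 * α v) (fun v => B F v) ↔ ∀ v, γ v = 2 * K F v := by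
  have : FiniteDimensional ℝ W := Module.finite_of_finrank_pos (by omega)
  -- Both sides equal 2 vol(q, F, e i), where q is dual to α: the left by the coordinate formula of
  -- the cross product, the right because K = ι_q vol.
  have key : ∀ e : Module.Basis (Fin 3) ℝ W, IsPosOrthonormal B o e → ∀ i,
      2 * α (e (i + 1)) * B F (e (i + 2)) - 2 * α (e (i + 2)) * B F (e (i + 1)) =
        2 * K F (e i) := by
    intro e he i
    have hq := hB.inverse_apply α
    rw [H.eq_tripleDet hK hq he, tripleDet_basis, ← hq, ← hq, ← coord_eq_inner he.1,
      ← coord_eq_inner he.1, ← coord_eq_inner he.1, ← coord_eq_inner he.1]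
    ring
  constructor
  · intro h v
    obtain ⟨e, he⟩ := hB.exists_isPosOrthonormal hW o
    have h1 : γ.toLinearMap = (2 • K F).toLinearMap := by
      refine e.ext fun i => ?_
      have := (h e he i).trans (key e he i)
      simpa using this
    simpa using congrArg (fun L => L v) h1
  · intro h e he i
    exact (h (e i)).trans (key e he i).symm

end Cross

/-! ### Integration in the fibre variable. -/

section PolynomialFlow

theorem eq_quadratic_of_deriv {g : ℝ → ℝ} {a c : ℝ}
    (h : ∀ t, HasDerivAt g (-a + 1 / 2 * c * t) t) (t : ℝ) :
    g t = g 0 - a * t + 1 / 4 * c * t ^ 2 := by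
  have h1 : ∀ t, HasDerivAt (fun t => g t - (-a * t + 1 / 4 * c * t ^ 2)) 0 t := by
    intro t
    have := (h t).sub (((hasDerivAt_id t).const_mul (-a)).add
      (((hasDerivAt_id t).pow 2).const_mul (1 / 4 * c)))
    refine this.congr_deriv ?_
    simp
    ring
  have := is_const_of_deriv_eq_zero (fun t => (h1 t).differentiableAt) (fun t => (h1 t).deriv) t 0
  simp at this
  linarith

end PolynomialFlow

/-! ### The soliton equation in terms of data on the base. -/

section Final

variable {W : Type*} [NormedAddCommGroup W] [NormedSpace ℝ W]
  {H : Type*} [TopologicalSpace H] {I : ModelWithCorners ℝ W H}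
  {N : Type*} [TopologicalSpace N] [ChartedSpace H N]

theorem contMDiff_slice {f : N × ℝ → ℝ} (hf : ContMDiff (I.prod 𝓘(ℝ, ℝ)) 𝓘(ℝ, ℝ) ∞ f) (t : ℝ) :
    ContMDiff I 𝓘(ℝ, ℝ) ∞ (fun z => f (z, t)) :=
  hf.comp (contMDiff_id.prodMk contMDiff_const)

/-- The left hand side of the soliton equation at `(x, t)`, evaluated on `(v, r)` and `(w, s)`, in
terms of data on the base; here `g'` stands for `∂f/∂t`. -/
def solitonExpression (h : ∀ x : N, TangentSpace I x →L[ℝ] TangentSpace I x →L[ℝ] ℝ)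
    (u : N → ℝ) (A : ∀ x : N, TangentSpace I x →L[ℝ] ℝ) (f : N × ℝ → ℝ)
    (F : ∀ x : N, TangentSpace I x) (a : ℝ) (x : N) (t g' : ℝ) (v w : TangentSpace I x)
    (r s : ℝ) : ℝ :=
  ricci I h x v w + a * (u x * h x v w + (u x)⁻¹ * ((r + A x v) * (s + A x w))) +
    1 / 2 * (t * (mvfderiv I u x (F x) * h x v w + u x * lieDeriv I h F x v w) -
      t * (u x)⁻¹ ^ 2 * mvfderiv I u x (F x) * ((r + A x v) * (s + A x w)) +
      (u x)⁻¹ * ((mvfderiv I (fun z => f (z, t)) x v + r * g' + t * extDerivOne I A x (F x) v) *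
          (s + A x w) +
        (mvfderiv I (fun z => f (z, t)) x w + s * g' + t * extDerivOne I A x (F x) w) *
          (r + A x v)) +
      u x * (r * h x (F x) w + s * h x (F x) v))

variable [I.Boundaryless] [IsManifold I ∞ N]

/-- The function is constant on the preimage of a ball in each chart, hence locally constant, and N
is preconnected. -/
theorem eq_const_of_mvfderiv_eq_zero [PreconnectedSpace N] [Nonempty N] {β : N → ℝ}
    (hβ : ContMDiff I 𝓘(ℝ, ℝ) ∞ β) (h : ∀ x v, mvfderiv I β x v = 0) : ∃ b, ∀ x, β x = b := by
  have hl : IsLocallyConstant β := by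
    rw [IsLocallyConstant.iff_eventually_eq]
    intro x
    obtain ⟨r, hr, hball⟩ := Metric.isOpen_iff.1 (isOpen_extChartAt_target (I := I) x) _
      (mem_extChartAt_target x)
    have hd : ∀ y ∈ Metric.ball (extChartAt I x x) r,
        fderiv ℝ (fun y => β ((extChartAt I x).symm y)) y = 0 := by
      intro y hy
      ext v
      rw [← mvfderiv_chartFrame hβ x (hball hy), h]
      rfl
    have hev : ∀ᶠ z in 𝓝 x, extChartAt I x z ∈ Metric.ball (extChartAt I x x) r :=
      (continuousAt_extChartAt x).eventually (Metric.ball_mem_nhds _ hr)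
    filter_upwards [hev, (isOpen_extChartAt_source (I := I) x).mem_nhds (mem_extChartAt_source x)]
      with z hz hz'
    have := Metric.isOpen_ball.is_const_of_fderiv_eq_zero
      (convex_ball (extChartAt I x x) r).isPreconnected
      (fun y hy => ((contDiffAt_comp_symm_chart hβ x (hball hy)).differentiableAt
        (by simp)).differentiableWithinAt) hd hz (Metric.mem_ball_self hr)
    rwa [(extChartAt I x).left_inv hz', extChartAt_to_inv] at this
  exact ⟨β (Classical.arbitrary N), fun x => hl.apply_eq_of_preconnectedSpace _ _⟩

variable [FiniteDimensional ℝ W]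

/-- Only E is assumed smooth. Its base component at t = 1 is F, and f is its fibre component plus t
A(F). -/
theorem contDiffAt_of_flowField {A : ∀ x : N, TangentSpace I x →L[ℝ] ℝ} [IsManifold I 1 N]
    [IsManifold (I.prod 𝓘(ℝ, ℝ)) 1 (N × ℝ)] (hA : IsFormOfClass I ∞ A) {f : N × ℝ → ℝ}
    {F : ∀ x : N, TangentSpace I x} (hE : IsFieldOfClass (I.prod 𝓘(ℝ, ℝ)) ∞ (flowField I A f F))
    (x : N) : ContDiffAt ℝ ∞ (fieldInChart I F x) (extChartAt I x x) ∧
      ∀ t : ℝ, ContDiffAt ℝ ∞ (fun p : W × ℝ => f ((extChartAt I x).symm p.1, p.2))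
        (extChartAt I x x, t) := by
  have hx := mem_extChartAt_target (I := I) x
  have h0 : ∀ t : ℝ, ContDiffAt ℝ ∞ (coordFlow (formInChart I A x)
      (fun p => f ((extChartAt I x).symm p.1, p.2)) (fieldInChart I F x))
      (extChartAt I x x, t) := by
    intro t
    refine (contDiffAt_fieldInChart hE (x, t) (mem_target_prod x t hx)).congr_of_eventuallyEq ?_
    filter_upwards [eventually_fst ((isOpen_extChartAt_target x).mem_nhds hx)] with p hp
    exact (fieldInChart_flowField f A F x t hp).symm
  have hF : ContDiffAt ℝ ∞ (fieldInChart I F x) (extChartAt I x x) := by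
    have h1 := (contDiffAt_fst.comp _ (h0 1)).comp (extChartAt I x x)
      (f := fun y => (y, (1 : ℝ))) (contDiffAt_id.prodMk contDiffAt_const)
    refine h1.congr_of_eventuallyEq (Filter.Eventually.of_forall fun y => ?_)
    simp [coordFlow]
  refine ⟨hF, fun t => ?_⟩
  have h1 := contDiffAt_snd.comp _ (h0 t)
  have h2 : ContDiffAt ℝ ∞ (fun p : W × ℝ => p.2 * formInChart I A x p.1 (fieldInChart I F x p.1))
      (extChartAt I x x, t) :=
    contDiffAt_snd.mul (((contDiffAt_formInChart hA x hx).comp (extChartAt I x x, t)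
      contDiffAt_fst).clm_apply (hF.comp (extChartAt I x x, t) contDiffAt_fst))
  refine (h1.add h2).congr_of_eventuallyEq (Filter.Eventually.of_forall fun y => ?_)
  simp [coordFlow]

theorem contMDiff_of_flowField {A : ∀ x : N, TangentSpace I x →L[ℝ] ℝ} [IsManifold I 1 N]
    [IsManifold (I.prod 𝓘(ℝ, ℝ)) 1 (N × ℝ)] (hA : IsFormOfClass I ∞ A) {f : N × ℝ → ℝ}
    {F : ∀ x : N, TangentSpace I x} (hE : IsFieldOfClass (I.prod 𝓘(ℝ, ℝ)) ∞ (flowField I A f F)) :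
    ContMDiff (I.prod 𝓘(ℝ, ℝ)) 𝓘(ℝ, ℝ) ∞ f := by
  rintro ⟨x, t⟩
  have h1 := (contDiffAt_of_flowField hA hE x).2 t
  have h2 : ContMDiffAt (I.prod 𝓘(ℝ, ℝ)) 𝓘(ℝ, W × ℝ) ∞
      (extChartAt (I.prod 𝓘(ℝ, ℝ)) ((x, t) : N × ℝ)) (x, t) := contMDiffAt_extChartAt
  rw [← extChartAt_prod_real_self] at h1
  refine (h1.contMDiffAt.comp _ h2).congr_of_eventuallyEq ?_
  filter_upwards [(isOpen_extChartAt_source (I := I.prod 𝓘(ℝ, ℝ)) ((x, t) : N × ℝ)).mem_nhds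
    (mem_extChartAt_source _)] with p hp
  rw [extChartAt_prod_real] at hp ⊢
  change f p = f ((extChartAt I x).symm (extChartAt I x p.1), p.2)
  rw [(extChartAt I x).left_inv hp.1]

/-- Near the centre of a chart the metric and E coincide with their coordinate models. The
coordinate Ricci and Lie derivative formulas therefore apply, and evaluation at the centre returns
the tensors on N. -/
theorem soliton_expression [IsManifold I 1 N] [IsManifold (I.prod 𝓘(ℝ, ℝ)) 1 (N × ℝ)]
    (hW : Module.finrank ℝ W = 3)
    {h : ∀ x : N, TangentSpace I x →L[ℝ] TangentSpace I x →L[ℝ] ℝ}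
    (hh : ContMDiff I (I.prod 𝓘(ℝ, W →L[ℝ] W →L[ℝ] ℝ)) ∞ (fun x =>
      Bundle.TotalSpace.mk' (W →L[ℝ] W →L[ℝ] ℝ)
        (E := fun x : N => TangentSpace I x →L[ℝ] TangentSpace I x →L[ℝ] ℝ) x (h x)))
    (hs : ∀ x v w, h x v w = h x w v) (hp : ∀ x v, v ≠ 0 → 0 < h x v v)
    {o : ∀ x : N, Orientation ℝ (TangentSpace I x) (Fin 3)} (ho : IsOrientation I o)
    {u : N → ℝ} (hu : ContMDiff I 𝓘(ℝ, ℝ) ∞ u) (hu_pos : ∀ x, 0 < u x)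
    {A : ∀ x : N, TangentSpace I x →L[ℝ] ℝ} (hA : IsFormOfClass I ∞ A)
    (monopole : ∀ x, IsHodgeStar (h x) (o x) (mvfderiv I u x) (extDerivOne I A x))
    {f : N × ℝ → ℝ} {F : ∀ x : N, TangentSpace I x}
    (hE : IsFieldOfClass (I.prod 𝓘(ℝ, ℝ)) ∞ (flowField I A f F)) (a : ℝ)
    (x : N) (t : ℝ) {g' : ℝ} (hg : HasDerivAt (fun s => f (x, s)) g' t) (v w : W) (r s : ℝ) :
    ricci (I.prod 𝓘(ℝ, ℝ)) (metric I h u A) (x, t) ((v, r) : W × ℝ) ((w, s) : W × ℝ) +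
        a * metric I h u A (x, t) ((v, r) : W × ℝ) ((w, s) : W × ℝ) +
        1 / 2 * lieDeriv (I.prod 𝓘(ℝ, ℝ)) (metric I h u A) (flowField I A f F) (x, t)
          ((v, r) : W × ℝ) ((w, s) : W × ℝ) =
      solitonExpression h u A f F a x t g' v w r s := by
  have hx := mem_extChartAt_target (I := I) x
  have hopen := (isOpen_extChartAt_target (I := I) x).mem_nhds hx
  set y₀ := extChartAt I x x with hy₀
  set hc := tensorInChart I h x with hhc
  set uc := fun y => u ((extChartAt I x).symm y) with huc
  set Ac := formInChart I A x with hAc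
  set Fc := fieldInChart I F x with hFc
  set fc := fun p : W × ℝ => f ((extChartAt I x).symm p.1, p.2) with hfc
  have hloc : IsLocalData hc uc Ac y₀ := by
    refine ⟨?_, ?_, ?_, ?_, ?_⟩
    · filter_upwards [eventually_mem_nhds_iff.2 hopen] with y hy using
        (contDiffOn_tensorInChart hh x).contDiffAt hy
    · filter_upwards [hopen] with y hy using isInnerForm_tensorInChart hs hp x hy
    · filter_upwards [hopen] with y hy using contDiffAt_comp_symm_chart hu x hy
    · exact Filter.Eventually.of_forall fun y => hu_pos _
    · filter_upwards [hopen] with y hy using contDiffAt_formInChart hA x hy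
  have hmono := isMonopoleNear_of_isHodgeStar (g := h) ho hu hA monopole x
  have hF := (contDiffAt_of_flowField hA hE x).1.differentiableAt (by simp)
  have hf := ((contDiffAt_of_flowField hA hE x).2 t).differentiableAt (by simp)
  have hpt := extChartAt_prod_real_self (I := I) x t
  have hGe : tensorInChart (I.prod 𝓘(ℝ, ℝ)) (metric I h u A) (x, t) =ᶠ[𝓝 (y₀, t)]
      coordMetric hc uc Ac := by
    filter_upwards [eventually_fst (p := (y₀, t)) hopen] with p hp
      using tensorInChart_metric h u A x t hp
  have hXe : fieldInChart (I.prod 𝓘(ℝ, ℝ)) (flowField I A f F) (x, t) =ᶠ[𝓝 (y₀, t)]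
      coordFlow Ac fc Fc := by
    filter_upwards [eventually_fst (p := (y₀, t)) hopen] with p hp
      using fieldInChart_flowField f A F x t hp
  have hu0 : uc y₀ = u x := congrArg u (extChartAt_to_inv x)
  have e1 : ricci (I.prod 𝓘(ℝ, ℝ)) (metric I h u A) (x, t) ((v, r) : W × ℝ) ((w, s) : W × ℝ) =
      ricci I h x v w := by
    refine (congrArg (fun p => coordRicci (tensorInChart (I.prod 𝓘(ℝ, ℝ)) (metric I h u A) (x, t))
      p ((v, r) : W × ℝ) ((w, s) : W × ℝ)) hpt).trans ?_
    exact (coordRicci_congr hGe _ _).trans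
      (coordRicci_coordMetric_of_monopole (p := (y₀, t)) hloc hW hmono _ _)
  have e2 : metric I h u A (x, t) ((v, r) : W × ℝ) ((w, s) : W × ℝ) = _ :=
    metric_apply_eq h u A x t (v, r) (w, s)
  have hdf : ∀ (v : W) (r : ℝ), fderiv ℝ fc (y₀, t) (v, r) =
      mvfderiv I (fun z => f (z, t)) x v + r * g' := by
    intro v r
    have d1 : fderiv ℝ fc (y₀, t) (v, 0) = mvfderiv I (fun z => f (z, t)) x v := by
      rw [mvfderiv_eq_fderiv_chart (contMDiff_slice (contMDiff_of_flowField hA hE) t)]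
      have hc1 : HasFDerivAt (fun y : W => (y, t)) (ContinuousLinearMap.inl ℝ W ℝ) y₀ :=
        hasFDerivAt_prodMk_left y₀ t
      have := hf.hasFDerivAt.comp y₀ hc1
      exact (congrArg (fun L => L v) this.fderiv).symm
    have d2 : fderiv ℝ fc (y₀, t) (0, 1) = g' := by
      have hc1 : HasFDerivAt (fun s : ℝ => (y₀, s)) (ContinuousLinearMap.inr ℝ W ℝ) t :=
        hasFDerivAt_prodMk_right y₀ t
      have h3 := (hf.hasFDerivAt.comp t hc1).hasDerivAt
      have h4 : (fc ∘ fun s : ℝ => (y₀, s)) = fun s => f (x, s) := by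
        funext s
        exact congrArg (fun z => f (z, s)) (extChartAt_to_inv x)
      rw [h4] at h3
      exact h3.unique hg
    have : ((v, r) : W × ℝ) = (v, 0) + r • (0, 1) := by simp
    rw [this, map_add, map_smul, d1, d2, smul_eq_mul]
  have e3 : lieDeriv (I.prod 𝓘(ℝ, ℝ)) (metric I h u A) (flowField I A f F) (x, t)
      ((v, r) : W × ℝ) ((w, s) : W × ℝ) =
      coordLieDeriv (coordMetric hc uc Ac) (coordFlow Ac fc Fc) (y₀, t) (v, r) (w, s) := by
    refine (congrArg (fun p => coordLieDeriv
      (tensorInChart (I.prod 𝓘(ℝ, ℝ)) (metric I h u A) (x, t))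
      (fieldInChart (I.prod 𝓘(ℝ, ℝ)) (flowField I A f F) (x, t))
      p ((v, r) : W × ℝ) ((w, s) : W × ℝ)) hpt).trans ?_
    exact coordLieDeriv_congr hGe hXe _ _
  have k1 : ∀ v w, hc y₀ v w = h x v w := tensorInChart_self h x
  have k2 : ∀ v, Ac y₀ v = A x v := formInChart_self A x
  -- The value F x is named as an element of W, so that the rewriting below does not mix W with the
  -- tangent space.
  obtain ⟨Fx, hFx⟩ : ∃ Fx : W, Fx = F x := ⟨_, rfl⟩
  have k3 : Fc y₀ = Fx := (fieldInChart_self F x).trans hFx.symm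
  have k4 : ∀ v, fderiv ℝ uc y₀ v = mvfderiv I u x v := fun v => (mvfderiv_eq_fderiv_chart hu x v).symm
  have k5 : ∀ v w, curl Ac y₀ v w = extDerivOne I A x v w := fun v w => rfl
  have k6 : coordLieDeriv hc Fc y₀ v w = lieDeriv I h F x v w := rfl
  rw [e1, e2, e3, coordLieDeriv_coordMetric (p := (y₀, t)) (f := fc) (F := Fc) hloc hf hF (v, r) (w, s)]
  simp only [connForm_apply, hdf, k1, k2, k3, k4, k5, k6, hu0]
  subst hFx
  rfl

end Final


/-! ### Vanishing on the zero vector, for the components with a vertical argument. -/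

section ZeroArguments

variable {W : Type*} [NormedAddCommGroup W] [NormedSpace ℝ W]

theorem coordRicci_zero_right (G : W → W →L[ℝ] W →L[ℝ] ℝ) (y v : W) : coordRicci G y v 0 = 0 := by
  have : curvatureMap G y v 0 = 0 := by
    ext u
    simp [curvatureMap_apply]
  rw [coordRicci, this]
  simp

variable {H : Type*} [TopologicalSpace H] {I : ModelWithCorners ℝ W H}
  {M : Type*} [TopologicalSpace M] [ChartedSpace H M]

theorem ricci_zero_right (g : ∀ x : M, TangentSpace I x →L[ℝ] TangentSpace I x →L[ℝ] ℝ) (x : M)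
    (v : TangentSpace I x) : ricci I g x v 0 = 0 :=
  coordRicci_zero_right _ _ _

theorem lieDeriv_zero_right (g : ∀ x : M, TangentSpace I x →L[ℝ] TangentSpace I x →L[ℝ] ℝ)
    (X : ∀ x : M, TangentSpace I x) (x : M) (v : TangentSpace I x) : lieDeriv I g X x v 0 = 0 := by
  change coordLieDeriv (tensorInChart I g x) (fieldInChart I X x) (extChartAt I x x) v 0 = 0
  simp [coordLieDeriv]

theorem extDerivOne_zero_right (A : ∀ x : M, TangentSpace I x →L[ℝ] ℝ) (x : M)
    (v : TangentSpace I x) : extDerivOne I A x v 0 = 0 :=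
  map_zero (curl (formInChart I A x) (extChartAt I x x) v)

end ZeroArguments

/-! ### Separation into the relations on the base. -/

section Relations

variable {W : Type*} [NormedAddCommGroup W] [NormedSpace ℝ W]
  {H : Type*} [TopologicalSpace H] {I : ModelWithCorners ℝ W H}
  {N : Type*} [TopologicalSpace N] [ChartedSpace H N]
  {h : ∀ x : N, TangentSpace I x →L[ℝ] TangentSpace I x →L[ℝ] ℝ}
  {u : N → ℝ} {A : ∀ x : N, TangentSpace I x →L[ℝ] ℝ} {f : N × ℝ → ℝ}
  {F : ∀ x : N, TangentSpace I x} {a : ℝ}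

theorem hasDerivAt_slice (hf : ContMDiff (I.prod 𝓘(ℝ, ℝ)) 𝓘(ℝ, ℝ) ∞ f) (x : N) (t : ℝ) :
    HasDerivAt (fun s => f (x, s)) (deriv (fun s => f (x, s)) t) t := by
  have : ContMDiff 𝓘(ℝ, ℝ) 𝓘(ℝ, ℝ) ∞ (fun s => f (x, s)) :=
    hf.comp (contMDiff_const.prodMk contMDiff_id)
  exact ((this.contDiff.contDiffAt (x := t)).differentiableAt (by simp)).hasDerivAt

/-- The vertical-vertical component: both arguments are ∂/∂t. -/
theorem deriv_of_solitonExpression (hu_pos : ∀ x, 0 < u x)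
    {x : N} {t g' : ℝ} (H : ∀ v w r s, solitonExpression h u A f F a x t g' v w r s = 0) :
    g' = -a + 1 / 2 * ((u x)⁻¹ * mvfderiv I u x (F x)) * t := by
  have h1 := H 0 0 1 1
  have h0 := (hu_pos x).ne'
  have z1 : h x 0 0 = 0 := map_zero _
  have z2 : A x 0 = 0 := map_zero _
  have z3 : h x (F x) 0 = 0 := map_zero _
  have z4 : mvfderiv I (fun z => f (z, t)) x 0 = 0 := map_zero _
  have z5 := ricci_zero_right h x 0
  have z6 := lieDeriv_zero_right h F x 0
  have z7 := extDerivOne_zero_right A x (F x)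
  rw [solitonExpression, z1, z2, z3, z4, z5, z6, z7] at h1
  field_simp at h1 ⊢
  linarith

/-- The mixed component: (v, -A v) is the horizontal lift of v, and it is paired with ∂/∂t. -/
theorem mvfderiv_of_solitonExpression (hu_pos : ∀ x, 0 < u x)
    {x : N} {t g' : ℝ} (H : ∀ v w r s, solitonExpression h u A f F a x t g' v w r s = 0) (v : TangentSpace I x) :
    mvfderiv I (fun z => f (z, t)) x v - g' * A x v + t * extDerivOne I A x (F x) v +
      u x ^ 2 * h x (F x) v = 0 := by
  have h1 := H v 0 (-A x v) 1
  have h0 := (hu_pos x).ne'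
  have z1 : h x v 0 = 0 := map_zero _
  have z2 : A x 0 = 0 := map_zero _
  have z3 : h x (F x) 0 = 0 := map_zero _
  have z4 : mvfderiv I (fun z => f (z, t)) x 0 = 0 := map_zero _
  have z5 := ricci_zero_right h x v
  have z6 := lieDeriv_zero_right h F x v
  have z7 := extDerivOne_zero_right A x (F x)
  rw [solitonExpression, z1, z2, z3, z4, z5, z6, z7] at h1
  have e := inv_mul_cancel₀ h0
  refine mul_left_cancel₀ (inv_ne_zero h0) ?_
  linear_combination 2 * h1 + u x * h x (F x) v * e

/-- The horizontal component: on two horizontal lifts all terms containing θ vanish. -/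
theorem ricci_of_solitonExpression
    {x : N} {t g' : ℝ} (H : ∀ v w r s, solitonExpression h u A f F a x t g' v w r s = 0) (v w : TangentSpace I x) :
    ricci I h x v w + a * u x * h x v w + 1 / 2 * (t * (mvfderiv I u x (F x) * h x v w +
      u x * lieDeriv I h F x v w) - u x * (A x v * h x (F x) w + A x w * h x (F x) v)) = 0 := by
  have h1 := H v w (-A x v) (-A x w)
  rw [solitonExpression] at h1
  linear_combination h1

/-- The relations on the base that are equivalent to the soliton equation, with `bA = 2 du × F♭`
rewritten by means of the monopole equation. -/
structure BaseRelations (h : ∀ x : N, TangentSpace I x →L[ℝ] TangentSpace I x →L[ℝ] ℝ)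
    (u : N → ℝ) (A : ∀ x : N, TangentSpace I x →L[ℝ] ℝ) (F : ∀ x : N, TangentSpace I x)
    (a b : ℝ) (f₀ : N → ℝ) : Prop where
  eq_const : ∀ x, b = (u x)⁻¹ * mvfderiv I u x (F x)
  form : ∀ x v, b * A x v = 2 * extDerivOne I A x (F x) v
  potential : ∀ x v, a * A x v + mvfderiv I f₀ x v + u x ^ 2 * h x (F x) v = 0
  lie : ∀ x v w, lieDeriv I h F x v w = -b * h x v w
  ricci : ∀ x v w, ricci I h x v w + a * u x * h x v w -
    u x * symProd (A x) (fun v => h x (F x) v) v w = 0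

theorem mvfderiv_quadratic {f₀ : N → ℝ} {b : ℝ} (hf₀ : ContMDiff I 𝓘(ℝ, ℝ) ∞ f₀)
    (hf : ∀ x t, f (x, t) = f₀ x - a * t + 1 / 4 * b * t ^ 2) (x : N) (t : ℝ) :
    mvfderiv I (fun z => f (z, t)) x = mvfderiv I f₀ x := by
  have h1 : (fun z => f (z, t)) = fun z => f₀ z + (-a * t + 1 / 4 * b * t ^ 2) := by
    funext z
    rw [hf]
    ring
  rw [h1, mvfderiv_fun_add ((hf₀ x).mdifferentiableAt (by simp)) mdifferentiableAt_const,
    mvfderiv_const, add_zero]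

theorem BaseRelations.solitonExpression_eq_zero (hu_pos : ∀ x, 0 < u x) {b : ℝ} {f₀ : N → ℝ}
    (R : BaseRelations h u A F a b f₀) (hf₀ : ContMDiff I 𝓘(ℝ, ℝ) ∞ f₀)
    (hf : ∀ x t, f (x, t) = f₀ x - a * t + 1 / 4 * b * t ^ 2) {x : N} {t g' : ℝ}
    (hg : HasDerivAt (fun s => f (x, s)) g' t) (v w : TangentSpace I x) (r s : ℝ) :
    solitonExpression h u A f F a x t g' v w r s = 0 := by
  have hg' : g' = -a + 1 / 2 * b * t := by
    refine hg.unique ?_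
    have h1 : (fun s => f (x, s)) = fun s => f₀ x - a * s + 1 / 4 * b * s ^ 2 := funext (hf x)
    rw [h1]
    refine ((((hasDerivAt_id t).const_mul a).const_sub (f₀ x)).add
      (((hasDerivAt_id t).pow 2).const_mul (1 / 4 * b))).congr_deriv ?_
    simp
    ring
  have hu0 := (hu_pos x).ne'
  have r1 : mvfderiv I u x (F x) = b * u x := by
    rw [R.eq_const x]
    field_simp
  have r5 : GibbonsHawking.ricci I h x v w + a * u x * h x v w -
    u x * (1 / 2 * (A x v * h x (F x) w + h x (F x) v * A x w)) = 0 := R.ricci x v w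
  rw [solitonExpression, mvfderiv_quadratic hf₀ hf, hg', r1, R.lie x v w]
  have r2v := R.form x v
  have r2w := R.form x w
  have r3v := R.potential x v
  have r3w := R.potential x w
  -- With g' = ∂f/∂t, the potential and form relations say L_E θ = g' θ - u² F♭. The F♭ part
  -- combines with the dt ⊗ F♭ terms and leaves only A ⊙ F♭.
  have e1 : (u x)⁻¹ * (mvfderiv I f₀ x v + r * (-a + 1 / 2 * b * t) +
      t * extDerivOne I A x (F x) v) =
      (u x)⁻¹ * ((r + A x v) * (-a + 1 / 2 * b * t)) - u x * h x (F x) v := by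
    field_simp
    linear_combination 2 * r3v - t * r2v
  have e2 : (u x)⁻¹ * (mvfderiv I f₀ x w + s * (-a + 1 / 2 * b * t) +
      t * extDerivOne I A x (F x) w) =
      (u x)⁻¹ * ((s + A x w) * (-a + 1 / 2 * b * t)) - u x * h x (F x) w := by
    field_simp
    linear_combination 2 * r3w - t * r2w
  have e3 : (u x)⁻¹ ^ 2 * (b * u x) = b * (u x)⁻¹ := by
    field_simp
  linear_combination r5 + 1 / 2 * (s + A x w) * e1 + 1 / 2 * (r + A x v) * e2 -
    1 / 2 * t * (r + A x v) * (s + A x w) * e3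

theorem exists_baseRelations [I.Boundaryless] [IsManifold I ∞ N] [PreconnectedSpace N]
    [Nonempty N] (hu_pos : ∀ x, 0 < u x)
    (hf : ContMDiff (I.prod 𝓘(ℝ, ℝ)) 𝓘(ℝ, ℝ) ∞ f)
    (H : ∀ x t g', HasDerivAt (fun s => f (x, s)) g' t → ∀ v w r s,
      solitonExpression h u A f F a x t g' v w r s = 0) :
    ∃ b : ℝ, (∀ x t, f (x, t) = f (x, 0) - a * t + 1 / 4 * b * t ^ 2) ∧
      BaseRelations h u A F a b (fun z => f (z, 0)) := by
  set β : N → ℝ := fun x => (u x)⁻¹ * mvfderiv I u x (F x) with hβ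
  have H' := fun x t => H x t _ (hasDerivAt_slice hf x t)
  have hd : ∀ x t, HasDerivAt (fun s => f (x, s)) (-a + 1 / 2 * β x * t) t := fun x t => by
    have := hasDerivAt_slice hf x t
    rwa [deriv_of_solitonExpression hu_pos (H' x t)] at this
  have hq : ∀ x t, f (x, t) = f (x, 0) - a * t + 1 / 4 * β x * t ^ 2 := fun x t =>
    eq_quadratic_of_deriv (hd x) t
  have H2 : ∀ x t (v : TangentSpace I x), mvfderiv I (fun z => f (z, t)) x v - (-a + 1 / 2 * β x * t) * A x v +
      t * extDerivOne I A x (F x) v + u x ^ 2 * h x (F x) v = 0 := fun x t =>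
    mvfderiv_of_solitonExpression hu_pos (H x t _ (hd x t))
  have H3 := fun x t => ricci_of_solitonExpression (H x t _ (hd x t))
  have hfs := contMDiff_slice hf
  have hsd : ∀ t x, MDifferentiableAt I 𝓘(ℝ, ℝ) (fun z => f (z, t)) x := fun t x =>
    (hfs t x).mdifferentiableAt (by simp)
  -- The second difference of f in t equals β/2. Taking it in the mixed equation, at t = 1, -1 and
  -- 0, cancels everything else and shows that its differential is zero.
  have hγ : ContMDiff I 𝓘(ℝ, ℝ) ∞ (fun z => f (z, 1) + f (z, -1) - (f (z, 0) + f (z, 0))) :=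
    ((hfs 1).add (hfs (-1))).sub ((hfs 0).add (hfs 0))
  obtain ⟨c, hc⟩ := eq_const_of_mvfderiv_eq_zero hγ fun x v => by
    rw [mvfderiv_fun_sub (g := fun z => f (z, 1) + f (z, -1)) (g' := fun z => f (z, 0) + f (z, 0))
      ((hsd _ x).add (hsd _ x)) ((hsd _ x).add (hsd _ x)), mvfderiv_fun_add (hsd _ x) (hsd _ x), mvfderiv_fun_add (hsd _ x) (hsd _ x)]
    have a1 := H2 x 1 v
    have a2 := H2 x (-1) v
    have a3 := H2 x 0 v
    change mvfderiv I (fun z => f (z, 1)) x v + mvfderiv I (fun z => f (z, -1)) x v -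
      (mvfderiv I (fun z => f (z, 0)) x v + mvfderiv I (fun z => f (z, 0)) x v) = 0
    linear_combination a1 + a2 - 2 * a3
  have hb : ∀ x, β x = 2 * c := fun x => by
    linear_combination 2 * hc x - 2 * hq x 1 - 2 * hq x (-1)
  have hq' : ∀ x t, f (x, t) = f (x, 0) - a * t + 1 / 4 * (2 * c) * t ^ 2 := fun x t => by
    rw [← hb x]
    exact hq x t
  refine ⟨2 * c, hq', fun x => (hb x).symm, fun x v => ?_, fun x v => ?_, fun x v w => ?_,
    fun x v w => ?_⟩
  -- By the quadratic form of f with constant coefficients, the base differential of f does not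
  -- depend on t. Comparing t = 1 with t = 0 thus isolates the coefficient of t.
  · have a1 := H2 x 1 v
    have a3 := H2 x 0 v
    have e1 := mvfderiv_quadratic (hfs 0) hq' x 1
    rw [e1, hb x] at a1
    linear_combination 2 * a3 - 2 * a1
  · linear_combination H2 x 0 v
  · have a1 := H3 x 1 v w
    have a3 := H3 x 0 v w
    have hu0 := (hu_pos x).ne'
    have e1 : mvfderiv I u x (F x) = 2 * c * u x := by
      rw [← hb x, hβ]
      field_simp
    rw [e1] at a1
    refine mul_left_cancel₀ hu0 ?_
    linear_combination 2 * a1 - 2 * a3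
  · change ricci I h x v w + a * u x * h x v w -
      u x * (1 / 2 * (A x v * h x (F x) w + h x (F x) v * A x w)) = 0
    linear_combination H3 x 0 v w

end Relations

end GibbonsHawking

end

/-! ### The theorem. -/

theorem corollary4p1
    {N : Type*} [TopologicalSpace N] [ChartedSpace (EuclideanSpace ℝ (Fin 3)) N]
    [IsManifold (𝓡 3) ω N] [PreconnectedSpace N]
    (h : Bundle.ContMDiffRiemannianMetric (𝓡 3) ω (EuclideanSpace ℝ (Fin 3))
      (TangentSpace (𝓡 3) : N → Type _))
    (o : ∀ x : N, Orientation ℝ (TangentSpace (𝓡 3) x) (Fin 3))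
    (ho : GibbonsHawking.IsOrientation (𝓡 3) o)
    (u : N → ℝ) (hu : ContMDiff (𝓡 3) 𝓘(ℝ, ℝ) ∞ u) (hu_pos : ∀ x, 0 < u x)
    (A : ∀ x : N, TangentSpace (𝓡 3) x →L[ℝ] ℝ)
    (hA : GibbonsHawking.IsFormOfClass (𝓡 3) ∞ A)
    (monopole : ∀ x, GibbonsHawking.IsHodgeStar (h.inner x) (o x)
      (mvfderiv (𝓡 3) u x) (GibbonsHawking.extDerivOne (𝓡 3) A x))
    (f : N × ℝ → ℝ) (F₁ : ∀ x : N, TangentSpace (𝓡 3) x)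
    (hE : GibbonsHawking.IsFieldOfClass ((𝓡 3).prod 𝓘(ℝ, ℝ)) ∞
      (GibbonsHawking.flowField (𝓡 3) A f F₁))
    (a : ℝ) :
    GibbonsHawking.IsSolitonFlow ((𝓡 3).prod 𝓘(ℝ, ℝ))
        (GibbonsHawking.metric (𝓡 3) h.inner u A) (GibbonsHawking.flowField (𝓡 3) A f F₁) a ↔
      ∃ (b : ℝ) (f₀ : N → ℝ), ContMDiff (𝓡 3) 𝓘(ℝ, ℝ) ∞ f₀ ∧
        (∀ (x : N) (t : ℝ), f (x, t) = f₀ x - a * t + 1 / 4 * b * t ^ 2) ∧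
        (∀ x, b = (u x)⁻¹ * mvfderiv (𝓡 3) u x (F₁ x)) ∧
        (∀ x, GibbonsHawking.IsCross (h.inner x) (o x) (fun v => b * A x v)
          (fun v => 2 * mvfderiv (𝓡 3) u x v) (fun v => h.inner x (F₁ x) v)) ∧
        (∀ x v, a * A x v + mvfderiv (𝓡 3) f₀ x v + u x ^ 2 * h.inner x (F₁ x) v = 0) ∧
        (∀ x v w, GibbonsHawking.lieDeriv (𝓡 3) h.inner F₁ x v w = -b * h.inner x v w) ∧
        (∀ x v w, GibbonsHawking.ricci (𝓡 3) h.inner x v w + a * u x * h.inner x v w -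
          u x * GibbonsHawking.symProd (A x) (fun v => h.inner x (F₁ x) v) v w = 0) := by
  have : IsManifold (𝓡 3) ∞ N := IsManifold.of_le (n := ω) le_top
  have hW : Module.finrank ℝ (EuclideanSpace ℝ (Fin 3)) = 3 := finrank_euclideanSpace_fin
  have hf := GibbonsHawking.contMDiff_of_flowField hA hE
  have key := fun x t g' hg v w r s => GibbonsHawking.soliton_expression hW
    (h.contMDiff.of_le le_top) h.symm h.pos ho hu hu_pos hA monopole hE a x t (g' := g') hg v w r s
  -- Applied with K the coordinate form of dA at the centre of the chart, which is `extDerivOne` by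
  -- definition.
  have cross : ∀ b : ℝ, (∀ x, GibbonsHawking.IsCross (h.inner x) (o x) (fun v => b * A x v)
      (fun v => 2 * mvfderiv (𝓡 3) u x v) (fun v => h.inner x (F₁ x) v)) ↔
      ∀ x v, b * A x v = 2 * GibbonsHawking.extDerivOne (𝓡 3) A x (F₁ x) v := fun b =>
    forall_congr' fun x => GibbonsHawking.isCross_iff (γ := b • A x)
      (K := GibbonsHawking.curl (GibbonsHawking.formInChart (𝓡 3) A x) (extChartAt (𝓡 3) x x))
      ⟨h.symm x, h.pos x⟩ hW (monopole x) (GibbonsHawking.curl_skew _ _) (F₁ x)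
  constructor
  · intro hS
    rcases isEmpty_or_nonempty N with hN | hN
    -- `PreconnectedSpace` admits the empty manifold, for which any b and f₀ serve.
    · exact ⟨0, fun _ => 0, contMDiff_const, hN.elim, hN.elim, hN.elim, hN.elim, hN.elim, hN.elim⟩
    obtain ⟨b, hq, R⟩ := GibbonsHawking.exists_baseRelations (h := h.inner) (u := u) (A := A)
      (f := f) (F := F₁) (a := a) hu_pos hf fun x t g' hg v w r s =>
        (key x t g' hg v w r s).symm.trans (hS (x, t) _ _)
    exact ⟨b, fun z => f (z, 0), GibbonsHawking.contMDiff_slice hf 0, hq, R.eq_const,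
      (cross b).2 R.form, R.potential, R.lie, R.ricci⟩
  · rintro ⟨b, f₀, hf₀, hq, h1, h2, h3, h4, h5⟩ ⟨x, t⟩ ⟨v, r⟩ ⟨w, s⟩
    have R : GibbonsHawking.BaseRelations h.inner u A F₁ a b f₀ :=
      ⟨h1, (cross b).1 h2, h3, h4, h5⟩
    have hg := GibbonsHawking.hasDerivAt_slice hf x t
    exact (key x t _ hg v w r s).trans
      (R.solitonExpression_eq_zero hu_pos hf₀ hq hg v w r s)
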